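/- **Notation.** $(a)_n=a(a+1)\cdots(a+n-1)$ is the Pochhammer symbol. For $\alpha,\beta,\kappa,\gamma_1,\gamma_2,x,y\in\mathbb C$ with $\mathrm{Re}\,\alpha,\mathrm{Re}\,\beta,\mathrm{Re}\,\kappa>0$ the bivariate Jacobi–Konhauser Mittag-Leffler (JKML) function is $$E^{(\gamma_1;\gamma_2)}_{\alpha,\beta,\kappa}(x,y)=\sum_{s=0}^\infty\sum_{r=0}^\infty\frac{(\gamma_1)_{r+s}(\gamma_2)_s\,x^s y^{\kappa r}}{r!\,s!\,\Gamma(\alpha+s)\Gamma(\beta+\kappa r)},$$ with principal powers of $y$. For $n\in\mathbb N_0$, $\kappa\in\{1,2,\dots\}$ and real $\alpha,\beta>-1$ the bivariate Jacobi–Konhauser polynomial is $${}_\kappa P_n^{(\alpha,\beta)}(x,y)=\frac{\Gamma(1+\alpha+n)}{n!}\sum_{s=0}^n\sum_{r=0}^{n-s}\frac{(-n)_{s+r}(1+\alpha+\beta+n)_s}{s!\,r!\,\Gamma(1+\alpha+s)\Gamma(\beta+1+\kappa r)}\Big(\frac{1-x}2\Big)^s y^{\kappa r}.$$ For $\rho>0$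 let $H_\rho$ be the Hankel contour that runs from $-\infty$ to $-\rho$ with $\arg u=-\pi$, then counterclockwise along $|u|=\rho$ with $\arg u$ from $-\pi$ to $\pi$, and back from $-\rho$ to $-\infty$ with $\arg u=\pi$; powers $u^z=e^{z(\log|u|+i\arg u)}$ on $H_\rho$ are taken with this argument, and $(y/w)^\kappa$ means $y^\kappa/w^\kappa$. **Theorem.** Let $\alpha,\beta,\kappa,\gamma_1,\gamma_2,x,y\in\mathbb C$ with $\mathrm{Re}\,\alpha,\mathrm{Re}\,\beta,\mathrm{Re}\,\kappa,\mathrm{Re}\,\gamma_2>0$. Call functions $R,S$ on $(0,\infty)$ with positive values *admissible* if for every $t>0$, $u\in H_{R(t)}$, $w\in H_{S(t)}$ $$\Big|\frac{y^\kappa}{w^\kappa}\Big|<1\quad\text{and}\quad\Big|\frac{t x w^\kappa}{u(w^\kappa-y^\kappa)}\Big|<1 .$$ 1. The double series of $E^{(\gamma_1;\gamma_2)}_{\alpha,\beta,\kappa}(x,y)$ converges absolutely if $|x|<1$ or if $-\gamma_1\in\mathbb N_0$. 2. Admissible $R,S$ exist. 3. If the double series converges absolutely at $(x,y)$, then for all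 admissible $R,S$ $$E^{(\gamma_1;\gamma_2)}_{\alpha,\beta,\kappa}(x,y)=\frac{-1}{4\pi^2\Gamma(\gamma_2)}\int_0^\infty\int_{H_{R(t)}}\int_{H_{S(t)}}t^{\gamma_2-1}u^{-\alpha}w^{-\beta}e^{u+w-t}\Big[1-\Big(\frac yw\Big)^\kappa-\frac{tx}u\Big]^{-\gamma_1}dw\,du\,dt,$$ where the bracket is raised to the principal power, the inner double integral converges absolutely for every $t>0$, and the resulting function of $t$ is absolutely integrable on $(0,\infty)$. **Corollary.** Let $n\in\mathbb N_0$, $\kappa\in\{1,2,\dots\}$, $\alpha,\beta>-1$ real with $1+\alpha+\beta+n>0$ (automatic for $n\ge1$), and $x,y\in\mathbb C$. Then for all functions $R,S$ on $(0,\infty)$ with positive values $${}_\kappa P_n^{(\alpha,\beta)}(x,y)=\frac{-\Gamma(1+\alpha+n)}{4\pi^2\,\Gamma(1+\alpha+\beta+n)\,n!}\int_0^\infty\int_{H_{R(t)}}\int_{H_{S(t)}}t^{\alpha+\beta+n}u^{-(1+\alpha)}w^{-(1+\beta)}e^{u+w-t}\Big[1-\Big(\frac yw\Big)^\kappa-\frac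 tu\Big(\frac{1-x}2\Big)\Big]^{n}dw\,du\,dt,$$ with the same convergence of the integrals. -/

import Mathlib

noncomputable section

namespace JKML

/-- The general term of the double series of the bivariate Jacobi Konhauser Mittag-Leffler
function; `(ascPochhammer ℂ n).eval a` is the Pochhammer symbol `(a)_n`. -/
def seriesTerm (α β κ γ₁ γ₂ x y : ℂ) (s r : ℕ) : ℂ :=
  (ascPochhammer ℂ (r + s)).eval γ₁ * (ascPochhammer ℂ s).eval γ₂ * x ^ s * y ^ (κ * (r : ℂ)) /
    ((r.factorial : ℂ) * (s.factorial : ℂ) * Complex.Gamma (α + s) * Complex.Gamma (β + κ * r))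

/-- Absolute convergence of the double series. -/
def SeriesConverges (α β κ γ₁ γ₂ x y : ℂ) : Prop :=
  Summable fun p : ℕ × ℕ => ‖seriesTerm α β κ γ₁ γ₂ x y p.1 p.2‖

/-- The bivariate Jacobi Konhauser Mittag-Leffler function. -/
def jkml (α β κ γ₁ γ₂ x y : ℂ) : ℂ :=
  ∑' s : ℕ, ∑' r : ℕ, seriesTerm α β κ γ₁ γ₂ x y s r

/-- The bivariate Jacobi Konhauser polynomial of degree index `n`. -/
def jkPoly (κ n : ℕ) (α β x y : ℂ) : ℂ :=
  Complex.Gamma (1 + α + n) / (n.factorial : ℂ) *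
    ∑ s ∈ Finset.range (n + 1), ∑ r ∈ Finset.range (n - s + 1),
      (ascPochhammer ℂ (s + r)).eval (-(n : ℂ)) * (ascPochhammer ℂ s).eval (1 + α + β + n) /
        ((s.factorial : ℂ) * (r.factorial : ℂ) * Complex.Gamma (1 + α + s) *
          Complex.Gamma (β + 1 + (κ : ℂ) * r)) * ((1 - x) / 2) ^ s * y ^ (κ * r)

/-- The Hankel contour of radius `ρ`, parametrized by `τ ∈ ℝ`, in the logarithmic coordinate:
`hankelLog ρ τ` is `log |u| + i arg u` at the point `u` of parameter `τ`.
For `τ < -π` the point runs from `-∞` to `-ρ` with `arg u = -π`, for `-π ≤ τ ≤ π` it runs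
counterclockwise along `|u| = ρ` with `arg u = τ`, for `τ > π` it returns from `-ρ` to `-∞`
with `arg u = π`. The power `u ^ z`, continuous along the contour, is `exp (z * hankelLog ρ τ)`. -/
def hankelLog (ρ τ : ℝ) : ℂ :=
  if τ < -Real.pi then (Real.log (ρ - Real.pi - τ) : ℂ) - Real.pi * Complex.I
  else if τ ≤ Real.pi then (Real.log ρ : ℂ) + τ * Complex.I
  else (Real.log (ρ - Real.pi + τ) : ℂ) + Real.pi * Complex.I

/-- The point `u` of parameter `τ` on the Hankel contour of radius `ρ`. -/
def hankelPt (ρ τ : ℝ) : ℂ := Complex.exp (hankelLog ρ τ)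

/-- The power `u ^ z` at the point of parameter `τ`, with `-π ≤ arg u ≤ π` as above. -/
def hankelPow (ρ τ : ℝ) (z : ℂ) : ℂ := Complex.exp (z * hankelLog ρ τ)

/-- The velocity `du/dτ` of the Hankel contour (away from the two corners `τ = ±π`). -/
def hankelVel (ρ τ : ℝ) : ℂ :=
  if τ < -Real.pi then 1
  else if τ ≤ Real.pi then Complex.I * hankelPt ρ τ
  else -1

/-- The conditions `|y^κ / w^κ| < 1` and `|t x w^κ / (u (w^κ - y^κ))| < 1` for every `t > 0`,
every `u` on the Hankel contour of radius `R t` and every `w` on that of radius `S t`. -/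
def AdmissibleRadii (κ x y : ℂ) (R S : ℝ → ℝ) : Prop :=
  ∀ t : ℝ, 0 < t → 0 < R t ∧ 0 < S t ∧ ∀ σ τ : ℝ,
    ‖y ^ κ / hankelPow (S t) τ κ‖ < 1 ∧
    ‖(t : ℂ) * x * hankelPow (S t) τ κ /
      (hankelPt (R t) σ * (hankelPow (S t) τ κ - y ^ κ))‖ < 1

/-- The integrand
`t^(γ₂-1) u^(-α) w^(-β) e^(u+w-t) [1 - (y/w)^κ - t x / u]^(-γ₁)` times `(du/dσ) (dw/dτ)`,
with `u`, `w` on the Hankel contours of radii `R`, `S` at the parameters `σ`, `τ`. -/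
def jkmlIntegrand (α β κ γ₁ γ₂ x y : ℂ) (R S t σ τ : ℝ) : ℂ :=
  (t : ℂ) ^ (γ₂ - 1) * hankelPow R σ (-α) * hankelPow S τ (-β) *
    Complex.exp (hankelPt R σ + hankelPt S τ - t) *
    (1 - y ^ κ / hankelPow S τ κ - t * x / hankelPt R σ) ^ (-γ₁) *
    (hankelVel R σ * hankelVel S τ)

/-- The integrand
`t^(α+β+n) u^(-(1+α)) w^(-(1+β)) e^(u+w-t) [1 - (y/w)^κ - (t/u) ((1-x)/2)]^n`
times `(du/dσ) (dw/dτ)`. -/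
def jkPolyIntegrand (κ n : ℕ) (α β x y : ℂ) (R S t σ τ : ℝ) : ℂ :=
  (t : ℂ) ^ (α + β + n) * hankelPow R σ (-(1 + α)) * hankelPow S τ (-(1 + β)) *
    Complex.exp (hankelPt R σ + hankelPt S τ - t) *
    (1 - (y / hankelPt S τ) ^ κ - t / hankelPt R σ * ((1 - x) / 2)) ^ n *
    (hankelVel R σ * hankelVel S τ)

end JKML

end

/-! Put a = (y/w)^κ and b = tx/u. Admissibility says |a| < 1 and |b/(1-a)| < 1. Hence 1-a-b =
(1-a)(1-b/(1-a)) with both factors in the right half-plane, the principal power is multiplicative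
here, and two binomial series give Σ_s Σ_r (γ₁)_{r+s} a^r b^s/(r! s!). Hankel's formula ∫ u^(-z) e^u
du = 2πi/Γ(z) turns the powers of u and w into -4π²/(Γ(α+s)Γ(β+κr)), and the Gamma integral turns
t^s into Γ(γ₂+s) = (γ₂)_s Γ(γ₂).

Two interchanges need care. Along the contours the pointwise strict inequalities have to become
uniform (`exists_uniform_bound`); the delicate point is the limit at infinity. In t, the radii are
arbitrary functions, so the integrand is not estimated directly: for each t the contour integral is
identified with a series in t, and `Gamma_re_add_natCast_le` bounds the L¹ norms of its terms by the
moduli of the terms of the double series.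

`hankel_integral` holds for 0 < Re z < 1 by shrinking the circle and using the reflection formula;
it extends by integration by parts and then by continuity. Estimating it on a contour of free radius
gives the decay of 1/Γ, hence convergence of the double series. In the corollary the bracket expands
into a finite sum, so the radii need only be positive. -/

open MeasureTheory Filter Topology Set

noncomputable section

namespace JKML

/-! ### Pochhammer symbols and binomial series with principal powers -/

/-- `Γ(z + n) = (z)_n Γ(z)` in the right half-plane. -/
lemma Gamma_add_natCast {z : ℂ} (hz : 0 < z.re) (n : ℕ) :
    Complex.Gamma (z + n) = (ascPochhammer ℂ n).eval z * Complex.Gamma z := by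
  induction n with
  | zero => simp
  | succ n ih =>
    have h : z + n ≠ 0 := by
      intro h
      have := congrArg Complex.re h
      simp at this
      have : (0 : ℝ) ≤ n := n.cast_nonneg
      linarith
    rw [ascPochhammer_succ_eval, Nat.cast_succ, ← add_assoc, Complex.Gamma_add_one _ h, ih]
    ring

lemma ascPochhammer_eval_add (a : ℂ) (m n : ℕ) :
    (ascPochhammer ℂ (m + n)).eval a =
      (ascPochhammer ℂ m).eval a * (ascPochhammer ℂ n).eval (a + m) := by
  rw [← ascPochhammer_mul]
  simp

/-- The binomial series of `(1 - z) ^ (-γ)`. -/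
lemma hasSum_one_sub_cpow (γ : ℂ) {z : ℂ} (hz : ‖z‖ < 1) :
    HasSum (fun n : ℕ => (ascPochhammer ℂ n).eval γ / (n.factorial : ℂ) * z ^ n)
      ((1 - z) ^ (-γ)) := by
  have h := (Complex.one_div_one_sub_cpow_hasFPowerSeriesOnBall_zero γ).hasSum (y := z)
    (by rw [Metric.mem_eball, edist_zero_right, ← ofReal_norm]
        exact ENNReal.ofReal_lt_one.2 hz)
  have e : ∀ n : ℕ, Ring.choose (γ + n - 1) n =
      (ascPochhammer ℂ n).eval γ / (n.factorial : ℂ) := fun n => by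
    rw [eq_div_iff (by exact_mod_cast n.factorial_ne_zero), Ring.choose]
    have := Ring.factorial_nsmul_multichoose_eq_ascPochhammer (γ : ℂ) n
    rw [Polynomial.ascPochhammer_smeval_eq_eval] at this
    rw [← this, show γ + n - 1 - n + 1 = γ by ring]
    simp [mul_comm]
  simp only [FormalMultilinearSeries.ofScalars_apply_eq, e, zero_add, one_div,
    smul_eq_mul] at h
  rw [Complex.cpow_neg]
  exact h

lemma summable_norm_binomialCoeff (γ : ℂ) {q : ℝ} (h0 : 0 ≤ q) (h1 : q < 1) :
    Summable fun n : ℕ => ‖(ascPochhammer ℂ n).eval γ / (n.factorial : ℂ)‖ * q ^ n := by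
  have h := (hasSum_one_sub_cpow γ (z := (q : ℂ)) (by simpa [abs_of_nonneg h0] using h1)).summable.norm
  simpa [abs_of_nonneg h0] using h

/-- The majorant depends on z only through q, so it is constant along the contours once the bound q
is uniform. -/
lemma norm_one_sub_cpow_le (γ : ℂ) {z : ℂ} {q : ℝ} (hz : ‖z‖ ≤ q) (hq : q < 1) :
    ‖(1 - z) ^ (-γ)‖ ≤ ∑' n : ℕ, ‖(ascPochhammer ℂ n).eval γ / (n.factorial : ℂ)‖ * q ^ n := by
  have hs := summable_norm_binomialCoeff γ ((norm_nonneg z).trans hz) hq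
  rw [← (hasSum_one_sub_cpow γ (hz.trans_lt hq)).tsum_eq]
  refine tsum_of_norm_bounded hs.hasSum fun n => ?_
  rw [norm_mul, norm_pow]
  gcongr

/-- Growth of the coefficients of `(1 - a - b) ^ (-γ)`. -/
lemma exists_norm_ascPochhammer_add_le (γ : ℂ) {a b : ℝ} (ha : 0 ≤ a) (hb : 0 ≤ b)
    (hab : a + b < 1) :
    ∃ M : ℝ, ∀ s r : ℕ, ‖(ascPochhammer ℂ (r + s)).eval γ‖ / (r.factorial * s.factorial) *
      b ^ s * a ^ r ≤ M := by
  have hs := summable_norm_binomialCoeff γ (add_nonneg ha hb) hab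
  -- M is the whole sum of the majorant at a + b. Its term of index r + s already suffices, since
  -- one summand of the binomial expansion of (a + b)^(r+s) is at most the total.
  refine ⟨_, fun s r => le_trans ?_ (hs.le_tsum (r + s) fun n _ => by positivity)⟩
  have h1 : ((r + s).choose r : ℝ) * (a ^ r * b ^ s) ≤ (a + b) ^ (r + s) := by
    rw [add_pow]
    refine le_trans (le_of_eq ?_) (Finset.single_le_sum
      (f := fun m => a ^ m * b ^ (r + s - m) * ((r + s).choose m : ℝ))
      (fun i _ => by positivity) (Finset.mem_range.2 (by omega : r < r + s + 1)))
    simp only [Nat.add_sub_cancel_left]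
    ring
  have h2 : ((r + s).choose r : ℝ) * (r.factorial * s.factorial) = (r + s).factorial := by
    have := Nat.choose_mul_factorial_mul_factorial (Nat.le_add_right r s)
    rw [Nat.add_sub_cancel_left] at this
    rw [← mul_assoc]
    exact_mod_cast this
  have h3 : ‖(ascPochhammer ℂ (r + s)).eval γ‖ / (r.factorial * s.factorial) * b ^ s * a ^ r =
      ‖(ascPochhammer ℂ (r + s)).eval γ / ((r + s).factorial : ℂ)‖ *
        (((r + s).choose r : ℝ) * (a ^ r * b ^ s)) := by
    rw [norm_div, Complex.norm_natCast, ← h2]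
    have : ((r + s).choose r : ℝ) ≠ 0 := by
      exact_mod_cast (Nat.choose_pos (by omega)).ne'
    field_simp
  rw [h3]
  gcongr

/-- The principal power of `1 - a - b = (1 - a) (1 - b / (1 - a))`. -/
lemma one_sub_sub_cpow (γ : ℂ) {a b : ℂ} (ha : ‖a‖ < 1) (hb : ‖b / (1 - a)‖ < 1) :
    (1 - a - b) ^ (-γ) = (1 - a) ^ (-γ) * (1 - b / (1 - a)) ^ (-γ) := by
  have re_pos : ∀ c : ℂ, ‖c‖ < 1 → 0 < (1 - c).re := fun c hc => by
    have := (Complex.re_le_norm c).trans_lt hc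
    simpa using this
  have h1 := re_pos a ha
  have h2 := re_pos _ hb
  have n1 : 1 - a ≠ 0 := fun h => by simp [h] at h1
  have n2 : 1 - b / (1 - a) ≠ 0 := fun h => by simp [h] at h2
  have e : 1 - a - b = (1 - a) * (1 - b / (1 - a)) := by field_simp
  -- Both arguments lie in (-π/2, π/2), so their sum stays within (-π, π) and the logarithms add.
  have a1 := abs_lt.1 (Complex.abs_arg_lt_pi_div_two_iff.2 (Or.inl h1))
  have a2 := abs_lt.1 (Complex.abs_arg_lt_pi_div_two_iff.2 (Or.inl h2))
  rw [e, Complex.cpow_def_of_ne_zero (mul_ne_zero n1 n2), Complex.cpow_def_of_ne_zero n1,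
    Complex.cpow_def_of_ne_zero n2, ← Complex.exp_add, Complex.log_mul n1 n2, add_mul]
  constructor <;> linarith

/-- Expansion of `(1 - a - b) ^ (-γ)` in powers of `b`. -/
lemma hasSum_one_sub_sub_cpow (γ : ℂ) {a b : ℂ} (ha : ‖a‖ < 1) (hb : ‖b / (1 - a)‖ < 1) :
    HasSum (fun s : ℕ => (ascPochhammer ℂ s).eval γ / (s.factorial : ℂ) * b ^ s *
      (1 - a) ^ (-(γ + s))) ((1 - a - b) ^ (-γ)) := by
  have n1 : 1 - a ≠ 0 := fun h => by
    rw [sub_eq_zero] at h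
    simp [← h] at ha
  rw [one_sub_sub_cpow γ ha hb]
  refine ((hasSum_one_sub_cpow γ hb).mul_left ((1 - a) ^ (-γ))).congr_fun (fun s => ?_)
  rw [neg_add, Complex.cpow_add _ _ n1, Complex.cpow_neg _ (s : ℂ), Complex.cpow_natCast, div_pow]
  field_simp

/-! ### Modulus, argument and decay along the Hankel contour -/

/-- The modulus of the point of parameter `τ` on the Hankel contour of radius `ρ`. -/
def hankelAbs (ρ τ : ℝ) : ℝ := ρ + max 0 (|τ| - Real.pi)

/-- The argument of the point of parameter `τ` on a Hankel contour. -/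
def hankelArg (τ : ℝ) : ℝ := max (-Real.pi) (min Real.pi τ)

lemma le_hankelAbs (ρ τ : ℝ) : ρ ≤ hankelAbs ρ τ := by
  simp [hankelAbs]

lemma hankelAbs_pos {ρ : ℝ} (hρ : 0 < ρ) (τ : ℝ) : 0 < hankelAbs ρ τ :=
  hρ.trans_le (le_hankelAbs ρ τ)

lemma abs_hankelArg_le (τ : ℝ) : |hankelArg τ| ≤ Real.pi := by
  have := Real.pi_pos
  rw [abs_le, hankelArg]
  exact ⟨le_max_left _ _, max_le (by linarith) (min_le_left _ _)⟩

lemma hankelLog_of_lt (ρ : ℝ) {τ : ℝ} (h : τ < -Real.pi) :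
    hankelLog ρ τ = (Real.log (ρ - Real.pi - τ) : ℂ) - Real.pi * Complex.I := by
  simp [hankelLog, h]

lemma hankelLog_of_mem (ρ : ℝ) {τ : ℝ} (h : τ ∈ Icc (-Real.pi) Real.pi) :
    hankelLog ρ τ = (Real.log ρ : ℂ) + τ * Complex.I := by
  simp [hankelLog, h.1.not_gt, h.2]

lemma hankelLog_of_gt (ρ : ℝ) {τ : ℝ} (h : Real.pi < τ) :
    hankelLog ρ τ = (Real.log (ρ - Real.pi + τ) : ℂ) + Real.pi * Complex.I := by
  have := Real.pi_pos
  simp [hankelLog, h.not_ge, (by linarith : ¬ τ < -Real.pi)]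

lemma hankelLog_eq (ρ τ : ℝ) :
    hankelLog ρ τ = (Real.log (hankelAbs ρ τ) : ℂ) + hankelArg τ * Complex.I := by
  have hpi := Real.pi_pos
  rcases lt_or_ge τ (-Real.pi) with h | h
  · rw [hankelLog_of_lt ρ h, hankelAbs, hankelArg, abs_of_neg (by linarith),
      max_eq_right (by linarith), min_eq_right (by linarith), max_eq_left h.le,
      show ρ + (-τ - Real.pi) = ρ - Real.pi - τ by ring]
    push_cast
    ring
  rcases le_or_gt τ Real.pi with h' | h'
  · rw [hankelLog_of_mem ρ ⟨h, h'⟩, hankelAbs, hankelArg,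
      max_eq_left (by linarith [abs_le.2 ⟨h, h'⟩]), min_eq_right h', max_eq_right h, add_zero]
  · rw [hankelLog_of_gt ρ h', hankelAbs, hankelArg, abs_of_pos (by linarith),
      max_eq_right (by linarith), min_eq_left h'.le, max_eq_right (by linarith),
      show ρ + (τ - Real.pi) = ρ - Real.pi + τ by ring]

lemma continuous_hankelLog {ρ : ℝ} (hρ : 0 < ρ) : Continuous (hankelLog ρ) := by
  have h1 : Continuous (hankelAbs ρ) := by unfold hankelAbs; fun_prop
  have h2 : Continuous hankelArg := by unfold hankelArg; fun_prop
  have h3 := h1.log fun τ => (hankelAbs_pos hρ τ).ne'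
  rw [show hankelLog ρ = fun τ => (Real.log (hankelAbs ρ τ) : ℂ) + hankelArg τ * Complex.I from
    funext (hankelLog_eq ρ)]
  fun_prop

lemma continuous_hankelPow {ρ : ℝ} (hρ : 0 < ρ) (z : ℂ) :
    Continuous fun τ => hankelPow ρ τ z := by
  have := continuous_hankelLog hρ
  unfold hankelPow
  fun_prop

lemma continuous_hankelPt {ρ : ℝ} (hρ : 0 < ρ) : Continuous (hankelPt ρ) := by
  have := continuous_hankelLog hρ
  unfold hankelPt
  fun_prop

lemma measurable_hankelVel {ρ : ℝ} (hρ : 0 < ρ) : Measurable (hankelVel ρ) := by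
  have := (continuous_hankelPt hρ).measurable
  unfold hankelVel
  exact Measurable.ite measurableSet_Iio measurable_const
    (Measurable.ite measurableSet_Iic (by fun_prop) measurable_const)

lemma hankelPt_ne_zero (ρ τ : ℝ) : hankelPt ρ τ ≠ 0 := Complex.exp_ne_zero _

lemma hankelPow_ne_zero (ρ τ : ℝ) (z : ℂ) : hankelPow ρ τ z ≠ 0 := Complex.exp_ne_zero _

lemma hankelPow_add (ρ τ : ℝ) (z w : ℂ) :
    hankelPow ρ τ (z + w) = hankelPow ρ τ z * hankelPow ρ τ w := by
  rw [hankelPow, add_mul, Complex.exp_add]; rfl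

lemma hankelPow_neg (ρ τ : ℝ) (z : ℂ) : hankelPow ρ τ (-z) = (hankelPow ρ τ z)⁻¹ := by
  rw [hankelPow, neg_mul, Complex.exp_neg]; rfl

lemma hankelPow_mul_natCast (ρ τ : ℝ) (z : ℂ) (n : ℕ) :
    hankelPow ρ τ (z * n) = hankelPow ρ τ z ^ n := by
  rw [hankelPow, hankelPow, ← Complex.exp_nat_mul]
  ring_nf

lemma hankelPow_natCast (ρ τ : ℝ) (n : ℕ) : hankelPow ρ τ n = hankelPt ρ τ ^ n := by
  rw [hankelPow, hankelPt, ← Complex.exp_nat_mul]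

lemma norm_hankelPt {ρ : ℝ} (hρ : 0 < ρ) (τ : ℝ) : ‖hankelPt ρ τ‖ = hankelAbs ρ τ := by
  rw [hankelPt, Complex.norm_exp, hankelLog_eq]
  simp [Real.exp_log (hankelAbs_pos hρ τ)]

lemma norm_hankelPow (ρ τ : ℝ) (z : ℂ) :
    ‖hankelPow ρ τ z‖ = Real.exp (z.re * Real.log (hankelAbs ρ τ) - z.im * hankelArg τ) := by
  rw [hankelPow, Complex.norm_exp, hankelLog_eq]
  simp

/-- For Re z ≥ 0 the smallest modulus ρ is the worst case, and the argument never exceeds π in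
absolute value. -/
lemma norm_hankelPow_neg_le {ρ : ℝ} (hρ : 0 < ρ) (τ : ℝ) {z : ℂ} (hz : 0 ≤ z.re) :
    ‖hankelPow ρ τ (-z)‖ ≤ Real.exp (Real.pi * |z.im| - z.re * Real.log ρ) := by
  rw [norm_hankelPow, Real.exp_le_exp]
  have h1 := Real.log_le_log hρ (le_hankelAbs ρ τ)
  have h2 : z.im * hankelArg τ ≤ |z.im| * Real.pi := (le_abs_self _).trans <| by
    rw [abs_mul]
    gcongr
    exact abs_hankelArg_le τ
  have h3 := mul_le_mul_of_nonneg_left h1 hz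
  simp only [Complex.neg_re, Complex.neg_im]
  linarith

lemma hankelPt_of_lt {ρ : ℝ} (hρ : 0 < ρ) {τ : ℝ} (h : τ < -Real.pi) :
    hankelPt ρ τ = -((ρ - Real.pi - τ : ℝ) : ℂ) := by
  rw [hankelPt, hankelLog_of_lt ρ h, Complex.exp_sub, Complex.exp_pi_mul_I, ← Complex.ofReal_exp,
    Real.exp_log (by linarith), div_neg, div_one]

lemma hankelPt_of_gt {ρ : ℝ} (hρ : 0 < ρ) {τ : ℝ} (h : Real.pi < τ) :
    hankelPt ρ τ = -((ρ - Real.pi + τ : ℝ) : ℂ) := by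
  rw [hankelPt, hankelLog_of_gt ρ h, Complex.exp_add, Complex.exp_pi_mul_I, ← Complex.ofReal_exp,
    Real.exp_log (by linarith)]
  simp

lemma hankelVel_of_lt (ρ : ℝ) {τ : ℝ} (h : τ < -Real.pi) : hankelVel ρ τ = 1 := by
  simp [hankelVel, h]

lemma hankelVel_of_mem (ρ : ℝ) {τ : ℝ} (h : τ ∈ Icc (-Real.pi) Real.pi) :
    hankelVel ρ τ = Complex.I * hankelPt ρ τ := by
  simp [hankelVel, h.1.not_gt, h.2]

lemma hankelVel_of_gt (ρ : ℝ) {τ : ℝ} (h : Real.pi < τ) : hankelVel ρ τ = -1 := by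
  have := Real.pi_pos
  simp [hankelVel, h.not_ge, (by linarith : ¬ τ < -Real.pi)]

/-- Exponential decay of `e ^ u du` along the Hankel contour. -/
lemma norm_exp_mul_hankelVel_le {ρ : ℝ} (hρ : 0 < ρ) (τ : ℝ) :
    ‖Complex.exp (hankelPt ρ τ) * hankelVel ρ τ‖ ≤
      (1 + ρ) * Real.exp (ρ + Real.pi) * Real.exp (-|τ|) := by
  have hpi := Real.pi_pos
  rw [norm_mul, mul_assoc, ← Real.exp_add, Complex.norm_exp]
  -- On both rays u = -r with r = ρ - π + |τ|. The factor 1 + ρ covers the speed, 1 on the rays and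
  -- ρ on the circle; e^π pays for e^(-|τ|) on the circle, where |τ| ≤ π.
  have ray : ∀ r : ℝ, r = ρ - Real.pi + |τ| →
      Real.exp (-r) ≤ (1 + ρ) * Real.exp (ρ + Real.pi + -|τ|) := fun r hr => by
    have : Real.exp (-r) ≤ Real.exp (ρ + Real.pi + -|τ|) := by
      gcongr
      linarith
    refine this.trans (le_mul_of_one_le_left (Real.exp_pos _).le (by linarith))
  rcases lt_or_ge τ (-Real.pi) with h | h
  · rw [hankelVel_of_lt ρ h, hankelPt_of_lt hρ h, norm_one, mul_one, Complex.neg_re,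
      Complex.ofReal_re]
    exact ray _ (by rw [abs_of_neg (by linarith)]; ring)
  rcases le_or_gt τ Real.pi with h' | h'
  · have hn : ‖hankelPt ρ τ‖ = ρ := by
      rw [norm_hankelPt hρ, hankelAbs, max_eq_left (by linarith [abs_le.2 ⟨h, h'⟩]), add_zero]
    have hre := (Complex.re_le_norm (hankelPt ρ τ)).trans_eq hn
    rw [hankelVel_of_mem ρ ⟨h, h'⟩, norm_mul, Complex.norm_I, one_mul, hn, mul_comm]
    gcongr
    · linarith
    · linarith [abs_le.2 ⟨h, h'⟩]
  · rw [hankelVel_of_gt ρ h', hankelPt_of_gt hρ h', norm_neg, norm_one, mul_one, Complex.neg_re,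
      Complex.ofReal_re]
    exact ray _ (by rw [abs_of_pos (by linarith)])

lemma integrable_exp_neg_abs : Integrable fun τ : ℝ => Real.exp (-|τ|) := by
  rw [← integrableOn_univ, ← Iic_union_Ioi (a := (0 : ℝ)), integrableOn_union]
  constructor
  · exact (integrableOn_exp_Iic 0).congr_fun
      (fun τ hτ => by simp [abs_of_nonpos (show τ ≤ 0 from hτ)]) measurableSet_Iic
  · exact (integrableOn_exp_neg_Ioi 0).congr_fun
      (fun τ hτ => by simp [abs_of_pos (show 0 < τ from hτ)]) measurableSet_Ioi

/-- The integrand `u ^ (-z) e ^ u du` of the Hankel integral. -/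
def hankelKernel (ρ : ℝ) (z : ℂ) (τ : ℝ) : ℂ :=
  hankelPow ρ τ (-z) * (Complex.exp (hankelPt ρ τ) * hankelVel ρ τ)

lemma norm_hankelKernel_le {ρ : ℝ} (hρ : 0 < ρ) {z : ℂ} (hz : 0 ≤ z.re) (τ : ℝ) :
    ‖hankelKernel ρ z τ‖ ≤ Real.exp (Real.pi * |z.im| - z.re * Real.log ρ) *
      ((1 + ρ) * Real.exp (ρ + Real.pi) * Real.exp (-|τ|)) := by
  rw [hankelKernel, norm_mul]
  gcongr
  · exact norm_hankelPow_neg_le hρ τ hz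
  · exact norm_exp_mul_hankelVel_le hρ τ

lemma measurable_hankelKernel {ρ : ℝ} (hρ : 0 < ρ) (z : ℂ) : Measurable (hankelKernel ρ z) := by
  have h1 := (continuous_hankelPow hρ (-z)).measurable
  have h2 := (continuous_hankelPt hρ).measurable
  have h3 := measurable_hankelVel hρ
  unfold hankelKernel
  fun_prop

lemma integrable_hankelKernel {ρ : ℝ} (hρ : 0 < ρ) {z : ℂ} (hz : 0 ≤ z.re) :
    Integrable (hankelKernel ρ z) :=
  Integrable.mono' ((integrable_exp_neg_abs.const_mul _).const_mul _)
    (measurable_hankelKernel hρ z).aestronglyMeasurable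
    (ae_of_all _ (norm_hankelKernel_le hρ hz))

/-! ### Hankel's formula for 1/Γ -/

/-- The function `r ↦ r ^ (-z) e ^ (-r)`. -/
def gammaDensity (z : ℂ) (r : ℝ) : ℂ := Complex.exp (-z * Real.log r) * Complex.exp (-r)

/-- The arc `u ^ (-z) e ^ u du` in the logarithmic coordinate `ζ = log u`. -/
def arcDensity (z ζ : ℂ) : ℂ := Complex.exp ((1 - z) * ζ + Complex.exp ζ)

lemma continuousOn_gammaDensity (z : ℂ) : ContinuousOn (gammaDensity z) (Ioi 0) := by
  have h : ContinuousOn (fun r : ℝ => (Real.log r : ℂ)) (Ioi 0) :=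
    Complex.continuous_ofReal.comp_continuousOn
      (Real.continuousOn_log.mono fun x hx => (show 0 < x from hx).ne')
  unfold gammaDensity
  fun_prop

lemma norm_gammaDensity (z : ℂ) (r : ℝ) :
    ‖gammaDensity z r‖ = Real.exp (-z.re * Real.log r) * Real.exp (-r) := by
  simp [gammaDensity, Complex.norm_exp]

lemma norm_gammaDensity_le {z : ℂ} (hz : 0 ≤ z.re) {ρ r : ℝ} (hρ : 0 < ρ) (hr : ρ ≤ r) :
    ‖gammaDensity z r‖ ≤ Real.exp (-z.re * Real.log ρ) * Real.exp (-r) := by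
  rw [norm_gammaDensity]
  gcongr 2
  have := mul_le_mul_of_nonneg_left (Real.log_le_log hρ hr) hz
  linarith

lemma integrableOn_gammaDensity {z : ℂ} (hz : 0 ≤ z.re) {ρ : ℝ} (hρ : 0 < ρ) :
    IntegrableOn (gammaDensity z) (Ioi ρ) := by
  refine Integrable.mono' ((integrableOn_exp_neg_Ioi ρ).const_mul
    (Real.exp (-z.re * Real.log ρ))) ?_ ?_
  · exact ((continuousOn_gammaDensity z).mono (Ioi_subset_Ioi hρ.le)).aestronglyMeasurable
      measurableSet_Ioi
  · exact (ae_restrict_mem measurableSet_Ioi).mono fun r hr =>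
      norm_gammaDensity_le hz hρ (show ρ < r from hr).le

lemma gammaDensity_eq {z : ℂ} {r : ℝ} (hr : 0 < r) :
    gammaDensity z r = (Real.exp (-r) : ℂ) * (r : ℂ) ^ ((1 - z) - 1) := by
  rw [gammaDensity, Complex.cpow_def_of_ne_zero (by exact_mod_cast hr.ne'), ← Complex.ofReal_log hr.le,
    Complex.ofReal_exp, mul_comm]
  push_cast
  ring_nf

lemma integrableOn_gammaDensity_Ioi_zero {z : ℂ} (hz : z.re < 1) :
    IntegrableOn (gammaDensity z) (Ioi 0) :=
  (Complex.GammaIntegral_convergent (s := 1 - z) (by simpa using hz)).congr_fun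
    (fun r hr => (gammaDensity_eq hr).symm) measurableSet_Ioi

lemma integral_gammaDensity {z : ℂ} (hz : z.re < 1) :
    ∫ r in Ioi 0, gammaDensity z r = Complex.Gamma (1 - z) := by
  rw [Complex.Gamma_eq_integral (by simpa using hz), Complex.GammaIntegral]
  exact setIntegral_congr_fun measurableSet_Ioi fun r hr => gammaDensity_eq hr

lemma setIntegral_comp_const_add_Ioi (f : ℝ → ℂ) (a d : ℝ) :
    ∫ x in Ioi a, f (d + x) = ∫ x in Ioi (d + a), f x := by
  rw [← integral_indicator measurableSet_Ioi, ← integral_indicator measurableSet_Ioi,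
    ← integral_add_left_eq_self ((Ioi (d + a)).indicator f) d]
  refine integral_congr_ae (ae_of_all _ fun x => ?_)
  simp [indicator, mem_Ioi]

lemma arcDensity_log_add (z : ℂ) (r θ : ℝ) :
    arcDensity z ((Real.log r : ℂ) + θ * Complex.I) =
      Complex.exp (-z * ((Real.log r : ℂ) + θ * Complex.I)) *
        Complex.exp (Complex.exp ((Real.log r : ℂ) + θ * Complex.I)) *
        Complex.exp ((Real.log r : ℂ) + θ * Complex.I) := by
  rw [arcDensity, ← Complex.exp_add, ← Complex.exp_add]
  ring_nf

/-- The Hankel integral as the contribution of the two rays and of the circle. -/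
lemma integral_hankelKernel_eq {ρ : ℝ} (hρ : 0 < ρ) {z : ℂ} (hz : 0 ≤ z.re) :
    ∫ τ, hankelKernel ρ z τ =
      (Complex.exp (z * (Real.pi * Complex.I)) - Complex.exp (-z * (Real.pi * Complex.I))) *
        (∫ r in Ioi ρ, gammaDensity z r) +
      Complex.I * ∫ θ in (-Real.pi)..Real.pi,
        arcDensity z ((Real.log ρ : ℂ) + θ * Complex.I) := by
  have hpi := Real.pi_pos
  have hi := integrable_hankelKernel hρ hz
  rw [← intervalIntegral.integral_Iic_add_Ioi (b := -Real.pi) hi.integrableOn hi.integrableOn,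
    ← intervalIntegral.integral_interval_add_Ioi (a := -Real.pi) (b := Real.pi)
      hi.integrableOn hi.integrableOn]
  -- With u = -r, the argument -π gives u^(-z) = r^(-z) e^(iπz) on the incoming ray. On the outgoing
  -- ray the phase is e^(-iπz) and the orientation is reversed.
  have h1 : ∫ τ in Iic (-Real.pi), hankelKernel ρ z τ =
      Complex.exp (z * (Real.pi * Complex.I)) * ∫ r in Ioi ρ, gammaDensity z r := by
    have e : ∫ τ in Iic (-Real.pi), gammaDensity z (ρ - Real.pi - τ) =
        ∫ r in Ioi ρ, gammaDensity z r := by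
      have := integral_comp_neg_Iic (-Real.pi) (fun x => gammaDensity z (ρ - Real.pi + x))
      simp only [← sub_eq_add_neg, neg_neg] at this
      rw [this, setIntegral_comp_const_add_Ioi, sub_add_cancel]
    -- The corner τ = -π belongs to the circle, so the ray formulas hold only on the open half-line.
    rw [← e, ← integral_const_mul, integral_Iic_eq_integral_Iio, integral_Iic_eq_integral_Iio]
    refine setIntegral_congr_fun measurableSet_Iio fun τ hτ => ?_
    simp only [hankelKernel, hankelPow, hankelPt_of_lt hρ hτ, hankelLog_of_lt ρ hτ,
      hankelVel_of_lt ρ hτ, mul_one, gammaDensity]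
    rw [← mul_assoc, ← Complex.exp_add, ← Complex.exp_add, ← Complex.exp_add]
    ring_nf
  have h2 : ∫ τ in Ioi Real.pi, hankelKernel ρ z τ =
      -Complex.exp (-z * (Real.pi * Complex.I)) * ∫ r in Ioi ρ, gammaDensity z r := by
    have e := setIntegral_comp_const_add_Ioi (gammaDensity z) Real.pi (ρ - Real.pi)
    rw [sub_add_cancel] at e
    rw [← e, ← integral_const_mul]
    refine setIntegral_congr_fun measurableSet_Ioi fun τ hτ => ?_
    simp only [hankelKernel, hankelPow, hankelPt_of_gt hρ hτ, hankelLog_of_gt ρ hτ,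
      hankelVel_of_gt ρ hτ, gammaDensity]
    rw [mul_add, Complex.exp_add]
    ring
  have h3 : ∫ τ in (-Real.pi)..Real.pi, hankelKernel ρ z τ =
      Complex.I * ∫ θ in (-Real.pi)..Real.pi,
        arcDensity z ((Real.log ρ : ℂ) + θ * Complex.I) := by
    rw [← intervalIntegral.integral_const_mul]
    refine intervalIntegral.integral_congr fun τ hτ => ?_
    rw [uIcc_of_le (by linarith)] at hτ
    simp only [hankelKernel, hankelPow, hankelVel_of_mem ρ hτ, arcDensity_log_add z ρ]
    rw [hankelPt, hankelLog_of_mem ρ hτ]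
    ring
  rw [h1, h2, h3]
  ring

/-- Cauchy's theorem between the circles of radii `ε` and `ρ`. -/
lemma integral_arcDensity_sub {ε ρ : ℝ} (hε : 0 < ε) (hερ : ε ≤ ρ) (z : ℂ) :
    Complex.I * (∫ θ in (-Real.pi)..Real.pi, arcDensity z ((Real.log ρ : ℂ) + θ * Complex.I)) =
      Complex.I * (∫ θ in (-Real.pi)..Real.pi, arcDensity z ((Real.log ε : ℂ) + θ * Complex.I)) +
      (Complex.exp (z * (Real.pi * Complex.I)) - Complex.exp (-z * (Real.pi * Complex.I))) *
        ∫ r in ε..ρ, gammaDensity z r := by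
  have hρ := hε.trans_le hερ
  have hd : Differentiable ℂ (arcDensity z) := by
    unfold arcDensity
    fun_prop
  -- In the coordinate ζ = log u the integrand is entire and the slit annulus is a rectangle: its
  -- vertical sides are the two circles, its horizontal sides the two edges of the cut.
  have H := Complex.integral_boundary_rect_eq_zero_of_differentiableOn (arcDensity z)
    ((Real.log ε : ℂ) + ((-Real.pi : ℝ) : ℂ) * Complex.I)
    ((Real.log ρ : ℂ) + (Real.pi : ℂ) * Complex.I) hd.differentiableOn
  simp only [Complex.add_re, Complex.add_im, Complex.ofReal_re, Complex.ofReal_im,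
    Complex.re_ofReal_mul, Complex.im_ofReal_mul, Complex.I_re, Complex.I_im, mul_zero, mul_one,
    add_zero, zero_add, smul_eq_mul] at H
  have sub : ∫ x in (Real.log ε)..(Real.log ρ), Real.exp x • gammaDensity z (Real.exp x) =
      ∫ r in ε..ρ, gammaDensity z r := by
    have := intervalIntegral.integral_deriv_smul_comp' (a := Real.log ε) (b := Real.log ρ)
      (f := Real.exp) (f' := Real.exp) (g := gammaDensity z)
      (fun x _ => Real.hasDerivAt_exp x) Real.continuous_exp.continuousOn
      ((continuousOn_gammaDensity z).mono (by
        rintro _ ⟨x, _, rfl⟩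
        exact Real.exp_pos x))
    rwa [Real.exp_log hε, Real.exp_log hρ] at this
  have ray : ∀ (x : ℝ) (c : ℂ), Complex.exp c = -1 →
      arcDensity z (x + c) =
        -Complex.exp (-z * c) * Real.exp x • gammaDensity z (Real.exp x) := fun x c hc => by
    rw [arcDensity, gammaDensity, Real.log_exp, Complex.exp_add x c, hc, Complex.real_smul,
      Complex.ofReal_exp]
    rw [show (1 - z) * (x + c) + Complex.exp x * -1 = c + (-z * c + (x + (-z * x + -Complex.exp x)))
      by ring, Complex.exp_add c, hc, Complex.exp_add, Complex.exp_add, Complex.exp_add]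
    ring
  have e1 : Complex.exp (((-Real.pi : ℝ) : ℂ) * Complex.I) = -1 := by
    rw [Complex.ofReal_neg, neg_mul, Complex.exp_neg, Complex.exp_pi_mul_I]
    norm_num
  simp_rw [fun x : ℝ => ray x _ e1, fun x : ℝ => ray x _ Complex.exp_pi_mul_I,
    intervalIntegral.integral_const_mul, sub] at H
  rw [show -z * (((-Real.pi : ℝ) : ℂ) * Complex.I) = z * (Real.pi * Complex.I) by
    push_cast; ring] at H
  linear_combination H

/-- For Re z < 1 the power of ε makes the circle disappear as ε → 0. -/
lemma norm_integral_arcDensity_le {ε : ℝ} (hε : 0 < ε) {z : ℂ} :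
    ‖∫ θ in (-Real.pi)..Real.pi, arcDensity z ((Real.log ε : ℂ) + θ * Complex.I)‖ ≤
      ε ^ (1 - z.re) * Real.exp (|z.im| * Real.pi + ε) * |Real.pi - -Real.pi| := by
  refine intervalIntegral.norm_integral_le_of_norm_le_const fun θ hθ => ?_
  have hpi := Real.pi_pos
  rw [uIoc_of_le (by linarith)] at hθ
  rw [arcDensity, Complex.norm_exp, Real.rpow_def_of_pos hε, ← Real.exp_add, Real.exp_le_exp]
  have h1 : z.im * θ ≤ |z.im| * Real.pi := (le_abs_self _).trans <| by
    rw [abs_mul]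
    gcongr
    exact abs_le.2 ⟨hθ.1.le, hθ.2⟩
  have h2 : (Complex.exp ((Real.log ε : ℂ) + θ * Complex.I)).re ≤ ε := by
    refine (Complex.re_le_norm _).trans_eq ?_
    simp [Complex.norm_exp, Real.exp_log hε]
  simp only [Complex.add_re, Complex.mul_re, Complex.sub_re, Complex.one_re, Complex.ofReal_re,
    Complex.I_re, Complex.ofReal_im, Complex.I_im, Complex.sub_im, Complex.one_im, Complex.add_im,
    Complex.mul_im] at h2 ⊢
  linarith

/-- By Cauchy's theorem the circle may shrink to 0. The two rays leave 2i sin(πz) Γ(1-z), which the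
reflection formula converts into 2πi/Γ(z). -/
lemma hankel_integral_of_re_lt_one {ρ : ℝ} (hρ : 0 < ρ) {z : ℂ} (h0 : 0 < z.re) (h1 : z.re < 1) :
    ∫ τ, hankelKernel ρ z τ = 2 * Real.pi * Complex.I / Complex.Gamma z := by
  set k := Complex.exp (z * (Real.pi * Complex.I)) - Complex.exp (-z * (Real.pi * Complex.I))
    with hk
  set ε : ℕ → ℝ := fun n => ρ / (n + 1) with hεdef
  have hε : ∀ n, 0 < ε n := fun n => by positivity
  have hερ : ∀ n, ε n ≤ ρ := fun n => div_le_self hρ.le (by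
    have : (0 : ℝ) ≤ n := n.cast_nonneg
    linarith)
  have hε0 : Tendsto ε atTop (𝓝 0) := by
    have := tendsto_one_div_add_atTop_nhds_zero_nat.const_mul ρ
    simpa [hεdef, div_eq_mul_inv] using this
  have key : ∀ n, ∫ τ, hankelKernel ρ z τ = k * (∫ r in Ioi (ε n), gammaDensity z r) +
      Complex.I * ∫ θ in (-Real.pi)..Real.pi,
        arcDensity z ((Real.log (ε n) : ℂ) + θ * Complex.I) := fun n => by
    rw [integral_hankelKernel_eq hρ h0.le, integral_arcDensity_sub (hε n) (hερ n),
      ← intervalIntegral.integral_interval_add_Ioi (a := ε n) (b := ρ)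
      (integrableOn_gammaDensity h0.le (hε n)) (integrableOn_gammaDensity h0.le hρ)]
    ring
  have hU : ⋃ n, Ioi (ε n) = Ioi 0 := by
    ext x
    simp only [mem_iUnion, mem_Ioi]
    exact ⟨fun ⟨n, hn⟩ => (hε n).trans hn, fun hx => (hε0.eventually_lt_const hx).exists⟩
  have t1 : Tendsto (fun n => ∫ r in Ioi (ε n), gammaDensity z r) atTop
      (𝓝 (Complex.Gamma (1 - z))) := by
    rw [← integral_gammaDensity h1, ← hU]
    refine tendsto_setIntegral_of_monotone (fun _ => measurableSet_Ioi) ?_ ?_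
    · intro m n hmn
      refine Ioi_subset_Ioi ?_
      simp only [hεdef]
      gcongr
    · rw [hU]
      exact integrableOn_gammaDensity_Ioi_zero h1
  have t2 : Tendsto (fun n => ∫ θ in (-Real.pi)..Real.pi,
      arcDensity z ((Real.log (ε n) : ℂ) + θ * Complex.I)) atTop (𝓝 0) := by
    refine squeeze_zero_norm (fun n => norm_integral_arcDensity_le (hε n)) ?_
    have a1 := hε0.rpow_const (p := 1 - z.re) (Or.inr (by linarith))
    have a2 : Tendsto (fun n => Real.exp (|z.im| * Real.pi + ε n)) atTop
      (𝓝 (Real.exp (|z.im| * Real.pi + 0))) :=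
      (Real.continuous_exp.tendsto _).comp (hε0.const_add _)
    have := (a1.mul a2).mul_const |Real.pi - -Real.pi|
    rwa [Real.zero_rpow (by linarith), zero_mul, zero_mul] at this
  have lim := (t1.const_mul k).add (t2.const_mul Complex.I)
  simp only [← key, mul_zero, add_zero] at lim
  rw [tendsto_nhds_unique tendsto_const_nhds lim]
  have g1 := Complex.Gamma_ne_zero_of_re_pos h0
  have g2 := Complex.Gamma_ne_zero_of_re_pos (s := 1 - z) (by simpa using h1)
  have hrefl := Complex.Gamma_mul_Gamma_one_sub z
  have hs : Complex.sin (Real.pi * z) ≠ 0 := fun h => by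
    rw [h, div_zero] at hrefl
    exact mul_ne_zero g1 g2 hrefl
  have hk' : k = 2 * Complex.I * Complex.sin (Real.pi * z) := by
    rw [hk, Complex.sin, show -z * (Real.pi * Complex.I) = -(Real.pi * z) * Complex.I by ring,
      show z * (Real.pi * Complex.I) = Real.pi * z * Complex.I by ring]
    linear_combination (Complex.exp (Real.pi * z * Complex.I) -
      Complex.exp (-(Real.pi * z) * Complex.I)) * Complex.I_sq
  rw [eq_div_iff hs] at hrefl
  rw [eq_div_iff g1, hk']
  linear_combination 2 * Complex.I * hrefl

/-- Integration by parts along the contour. -/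
lemma hankel_integral_succ {ρ : ℝ} (hρ : 0 < ρ) {z : ℂ} (h0 : 0 ≤ z.re) :
    ∫ τ, hankelKernel ρ z τ = z * ∫ τ, hankelKernel ρ (z + 1) τ := by
  have h0' : 0 ≤ (z + 1).re := by simp; linarith
  have hpi := Complex.exp_pi_mul_I
  -- The identity d(u^(-z) e^u) = u^(-z) e^u du - z u^(-z-1) e^u du is integrated over the rays
  -- (`U`) and the circle (`C`); their boundary terms at radius ρ cancel.
  have U : ∫ r in Ioi ρ, gammaDensity z r =
      gammaDensity z ρ - z * ∫ r in Ioi ρ, gammaDensity (z + 1) r := by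
    have i1 := integrableOn_gammaDensity h0 hρ
    have i2 := integrableOn_gammaDensity h0' hρ
    have H := integral_Ioi_of_hasDerivAt_of_tendsto' (a := ρ) (m := 0) (f := gammaDensity z)
      (f' := fun r => -z * gammaDensity (z + 1) r - gammaDensity z r) (fun r hr => ?_)
      ((i2.const_mul (-z)).sub i1) ?_
    · rw [integral_sub (i2.const_mul (-z)) i1, integral_const_mul] at H
      linear_combination -H
    · have hr0 : 0 < r := hρ.trans_le hr
      have hr1 : (r : ℂ) ≠ 0 := by exact_mod_cast hr0.ne'
      have d1 : HasDerivAt (fun r : ℝ => (Real.log r : ℂ)) ((r⁻¹ : ℝ) : ℂ) r :=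
        (Real.hasDerivAt_log hr0.ne').ofReal_comp
      have d2 : HasDerivAt (fun r : ℝ => (-r : ℂ)) (-1) r := (Complex.ofRealCLM.hasDerivAt (x := r)).neg
      have d := ((d1.const_mul (-z)).cexp).mul d2.cexp
      refine d.congr_deriv ?_
      have : Complex.exp (-(z + 1) * Real.log r) = Complex.exp (-z * Real.log r) * (r : ℂ)⁻¹ := by
        rw [neg_add, add_mul, Complex.exp_add, neg_one_mul, Complex.exp_neg, ← Complex.ofReal_exp,
          Real.exp_log hr0]
      simp only [gammaDensity, this]
      push_cast
      ring
    · have e0 : Tendsto (fun r : ℝ => Real.exp (-z.re * Real.log ρ) * Real.exp (-r)) atTop (𝓝 0) := by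
        simpa using Real.tendsto_exp_neg_atTop_nhds_zero.const_mul (Real.exp (-z.re * Real.log ρ))
      refine squeeze_zero_norm' ?_ e0
      filter_upwards [eventually_ge_atTop ρ] with r hr using norm_gammaDensity_le h0 hρ hr
  have C : Complex.I * (∫ θ in (-Real.pi)..Real.pi,
        arcDensity z ((Real.log ρ : ℂ) + θ * Complex.I)) =
      (Complex.exp (-z * (Real.pi * Complex.I)) - Complex.exp (z * (Real.pi * Complex.I))) *
        gammaDensity z ρ + z * (Complex.I * ∫ θ in (-Real.pi)..Real.pi,
        arcDensity (z + 1) ((Real.log ρ : ℂ) + θ * Complex.I)) := by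
    have hc : ∀ w : ℂ, Continuous fun θ : ℝ =>
        arcDensity w ((Real.log ρ : ℂ) + θ * Complex.I) := fun w => by
      unfold arcDensity
      fun_prop
    have H := intervalIntegral.integral_eq_sub_of_hasDerivAt (a := -Real.pi) (b := Real.pi)
      (f := fun θ : ℝ => Complex.exp (-z * ((Real.log ρ : ℂ) + θ * Complex.I) +
        Complex.exp ((Real.log ρ : ℂ) + θ * Complex.I)))
      (f' := fun θ : ℝ => Complex.I * arcDensity z ((Real.log ρ : ℂ) + θ * Complex.I) -
        z * (Complex.I * arcDensity (z + 1) ((Real.log ρ : ℂ) + θ * Complex.I)))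
      (fun θ _ => ?_) ?_
    · rw [intervalIntegral.integral_sub, intervalIntegral.integral_const_mul,
        intervalIntegral.integral_const_mul, intervalIntegral.integral_const_mul] at H
      · have v : ∀ c : ℂ, Complex.exp c = -1 → Complex.exp (-z * ((Real.log ρ : ℂ) + c) +
            Complex.exp ((Real.log ρ : ℂ) + c)) = Complex.exp (-z * c) * gammaDensity z ρ :=
          fun c hc => by
            rw [Complex.exp_add _ c, hc, ← Complex.ofReal_exp, Real.exp_log hρ, gammaDensity,
              ← Complex.exp_add, ← Complex.exp_add]
            ring_nf
        have e1 : Complex.exp (((-Real.pi : ℝ) : ℂ) * Complex.I) = -1 := by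
          rw [Complex.ofReal_neg, neg_mul, Complex.exp_neg, Complex.exp_pi_mul_I]
          norm_num
        rw [v _ hpi, v _ e1, show -z * (((-Real.pi : ℝ) : ℂ) * Complex.I) =
          z * (Real.pi * Complex.I) by push_cast; ring] at H
        linear_combination H
      · exact ((hc z).const_mul _).intervalIntegrable _ _
      · exact (((hc (z + 1)).const_mul _).const_mul _).intervalIntegrable _ _
    · have d1 : HasDerivAt (fun θ : ℝ => (Real.log ρ : ℂ) + θ * Complex.I) Complex.I θ := by
        simpa using ((Complex.ofRealCLM.hasDerivAt (x := θ)).mul_const Complex.I).const_add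
          (Real.log ρ : ℂ)
      refine ((d1.const_mul (-z)).add d1.cexp).cexp.congr_deriv ?_
      simp only [Pi.add_apply]
      set ζ := (Real.log ρ : ℂ) + θ * Complex.I
      rw [arcDensity, arcDensity, show (1 - z) * ζ + Complex.exp ζ = (-z * ζ + Complex.exp ζ) + ζ by ring,
        show (1 - (z + 1)) * ζ + Complex.exp ζ = -z * ζ + Complex.exp ζ by ring, Complex.exp_add _ ζ]
      ring
    · exact (((hc z).const_mul _).sub (((hc (z + 1)).const_mul _).const_mul _)).intervalIntegrable _ _
  rw [integral_hankelKernel_eq hρ h0, integral_hankelKernel_eq hρ h0', C, U]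
  have s1 : Complex.exp ((z + 1) * (Real.pi * Complex.I)) =
      -Complex.exp (z * (Real.pi * Complex.I)) := by
    rw [add_mul, one_mul, Complex.exp_add, hpi]; ring
  have s2 : Complex.exp (-(z + 1) * (Real.pi * Complex.I)) =
      -Complex.exp (-z * (Real.pi * Complex.I)) := by
    rw [neg_add, add_mul, Complex.exp_add, neg_one_mul, Complex.exp_neg (_ * Complex.I), hpi]
    norm_num
  rw [s1, s2]
  ring

/-- Integration by parts matches Γ(z+1) = zΓ(z), so the formula spreads from the strip to its right
translates. -/
lemma hankel_integral_of_fract {ρ : ℝ} (hρ : 0 < ρ) {z : ℂ} (h0 : 0 < z.re) (h1 : z.re < 1)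
    (n : ℕ) :
    ∫ τ, hankelKernel ρ (z + n) τ = 2 * Real.pi * Complex.I / Complex.Gamma (z + n) := by
  induction n with
  | zero => simpa using hankel_integral_of_re_lt_one hρ h0 h1
  | succ n ih =>
    have hre : 0 < (z + n).re := by
      have : (0 : ℝ) ≤ n := n.cast_nonneg
      simp
      linarith
    have hne : z + n ≠ 0 := fun h => by simp [h] at hre
    have g := Complex.Gamma_ne_zero_of_re_pos hre
    rw [hankel_integral_succ hρ hre.le] at ih
    rw [Nat.cast_succ, ← add_assoc, Complex.Gamma_add_one _ hne]
    field_simp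
    field_simp at ih
    linear_combination ih

/-- **Hankel's formula** for `1 / Γ` in the right half-plane. -/
theorem hankel_integral {ρ : ℝ} (hρ : 0 < ρ) {z : ℂ} (hz : 0 < z.re) :
    ∫ τ, hankelKernel ρ z τ = 2 * Real.pi * Complex.I / Complex.Gamma z := by
  have hfr : ∀ w : ℂ, 0 < w.re → Int.fract w.re ≠ 0 →
      ∫ τ, hankelKernel ρ w τ = 2 * Real.pi * Complex.I / Complex.Gamma w := fun w hw hf => by
    have hfl : ((⌊w.re⌋₊ : ℕ) : ℝ) = w.re - Int.fract w.re := by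
      rw [natCast_floor_eq_intCast_floor hw.le, Int.self_sub_fract]
    have hre : (w - (⌊w.re⌋₊ : ℂ)).re = Int.fract w.re := by
      simp [hfl]
    have := hankel_integral_of_fract hρ (z := w - ⌊w.re⌋₊)
      (by rw [hre]; exact lt_of_le_of_ne (Int.fract_nonneg _) hf.symm)
      (by rw [hre]; exact Int.fract_lt_one _) ⌊w.re⌋₊
    simpa using this
  by_cases hf : Int.fract z.re = 0
  swap
  · exact hfr z hz hf
  -- Integer real parts are missed by the translated strips and are reached as limits. The
  -- denominator n + 2 keeps the fractional part strictly between 0 and 1 from n = 0 on.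
  set w : ℕ → ℂ := fun n => z + ((1 / ((n : ℝ) + 2) : ℝ) : ℂ) with hw
  have hδ : Tendsto (fun n : ℕ => 1 / ((n : ℝ) + 2)) atTop (𝓝 0) := by
    have := (tendsto_add_atTop_iff_nat 1).2 (tendsto_one_div_add_atTop_nhds_zero_nat (𝕜 := ℝ))
    refine this.congr fun n => ?_
    push_cast
    ring
  have hwz : Tendsto w atTop (𝓝 z) := by
    have := ((Complex.continuous_ofReal.tendsto 0).comp hδ).const_add z
    simpa [hw, Function.comp_def] using this
  have hδ1 : ∀ n : ℕ, 0 < 1 / ((n : ℝ) + 2) ∧ 1 / ((n : ℝ) + 2) < 1 := fun n => by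
    have : (0 : ℝ) ≤ n := n.cast_nonneg
    exact ⟨by positivity, by rw [div_lt_one (by positivity)]; linarith⟩
  have hwre : ∀ n, (w n).re = z.re + 1 / ((n : ℝ) + 2) := fun n => by
    simp only [hw, Complex.add_re, Complex.ofReal_re]
  have hwim : ∀ n, (w n).im = z.im := fun n => by
    simp only [hw, Complex.add_im, Complex.ofReal_im, add_zero]
  have hwpos : ∀ n, 0 < (w n).re := fun n => by rw [hwre]; linarith [(hδ1 n).1]
  have hval : ∀ n, ∫ τ, hankelKernel ρ (w n) τ =
      2 * Real.pi * Complex.I / Complex.Gamma (w n) := fun n => by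
    refine hfr _ (hwpos n) ?_
    have : Int.fract (w n).re = 1 / ((n : ℝ) + 2) := by
      rw [hwre, ← Int.floor_add_fract z.re, hf, add_zero, Int.fract_intCast_add]
      exact Int.fract_eq_self.2 ⟨(hδ1 n).1.le, (hδ1 n).2⟩
    rw [this]
    exact (hδ1 n).1.ne'
  have lim1 : Tendsto (fun n => ∫ τ, hankelKernel ρ (w n) τ) atTop
      (𝓝 (∫ τ, hankelKernel ρ z τ)) := by
    refine tendsto_integral_of_dominated_convergence
      (fun τ => Real.exp (Real.pi * |z.im| + (z.re + 1) * |Real.log ρ|) *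
        ((1 + ρ) * Real.exp (ρ + Real.pi) * Real.exp (-|τ|)))
      (fun n => (measurable_hankelKernel hρ _).aestronglyMeasurable)
      ((integrable_exp_neg_abs.const_mul _).const_mul _) (fun n => ae_of_all _ fun τ => ?_)
      (ae_of_all _ fun τ => ?_)
    · refine (norm_hankelKernel_le hρ (hwpos n).le τ).trans ?_
      gcongr ?_ * _
      rw [Real.exp_le_exp, hwim]
      have a1 : -((w n).re * Real.log ρ) ≤ (w n).re * |Real.log ρ| := by
        rw [← mul_neg]
        exact mul_le_mul_of_nonneg_left (neg_le_abs _) (hwpos n).le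
      have a2 : (w n).re * |Real.log ρ| ≤ (z.re + 1) * |Real.log ρ| := by
        refine mul_le_mul_of_nonneg_right ?_ (abs_nonneg _)
        rw [hwre]
        linarith [(hδ1 n).2]
      linarith
    · have hc : Continuous fun v : ℂ => hankelKernel ρ v τ := by
        unfold hankelKernel hankelPow
        fun_prop
      exact (hc.tendsto z).comp hwz
  have lim2 : Tendsto (fun n => 2 * Real.pi * Complex.I / Complex.Gamma (w n)) atTop
      (𝓝 (2 * Real.pi * Complex.I / Complex.Gamma z)) := by
    have hG : Continuous fun v : ℂ => (Complex.Gamma v)⁻¹ :=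
      Complex.differentiable_one_div_Gamma.continuous
    simpa only [div_eq_mul_inv, Function.comp_def] using ((hG.tendsto z).comp hwz).const_mul (2 * Real.pi * Complex.I)
  simp only [hval] at lim1
  exact tendsto_nhds_unique lim1 lim2

/-! ### Decay of 1/Γ and absolute convergence of the double series -/

/-- Superexponential decay of `1 / Γ` in the right half-plane. -/
lemma exists_norm_inv_Gamma_le {ρ : ℝ} (hρ : 0 < ρ) :
    ∃ K : ℝ, 0 ≤ K ∧ ∀ z : ℂ, 0 < z.re →
      ‖(Complex.Gamma z)⁻¹‖ ≤ K * Real.exp (Real.pi * |z.im| - z.re * Real.log ρ) := by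
  set M := ∫ τ : ℝ, (1 + ρ) * Real.exp (ρ + Real.pi) * Real.exp (-|τ|) with hM
  have hM0 : 0 ≤ M := integral_nonneg fun τ => by positivity
  have hpi := Real.pi_pos
  refine ⟨M / (2 * Real.pi), by positivity, fun z hz => ?_⟩
  have h := norm_integral_le_of_norm_le
    ((integrable_exp_neg_abs.const_mul ((1 + ρ) * Real.exp (ρ + Real.pi))).const_mul
      (Real.exp (Real.pi * |z.im| - z.re * Real.log ρ)))
    (ae_of_all _ (norm_hankelKernel_le hρ hz.le))
  rw [hankel_integral hρ hz, integral_const_mul, ← hM, div_eq_mul_inv, norm_mul] at h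
  have h2 : ‖(2 * Real.pi * Complex.I : ℂ)‖ = 2 * Real.pi := by
    simp [abs_of_pos hpi]
  rw [h2] at h
  rw [div_mul_eq_mul_div, le_div_iff₀ (by positivity)]
  linarith

lemma summable_norm_pow_div_Gamma {β κ : ℂ} (hβ : 0 < β.re) (hκ : 0 < κ.re) (c : ℝ) :
    Summable fun r : ℕ => |c| ^ r * ‖(Complex.Gamma (β + κ * r))⁻¹‖ := by
  -- The radius e^L is chosen so that each step r → r + 1 gains exactly the factor 1/(2(|c|+1)),
  -- which leaves a geometric series of ratio at most 1/2.
  set L := (Real.log (2 * (|c| + 1)) + Real.pi * |κ.im|) / κ.re with hL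
  obtain ⟨K, hK0, hK⟩ := exists_norm_inv_Gamma_le (Real.exp_pos L)
  have hq : Real.exp (Real.pi * |κ.im| - κ.re * L) = (2 * (|c| + 1))⁻¹ := by
    have : κ.re * L = Real.log (2 * (|c| + 1)) + Real.pi * |κ.im| := by
      rw [hL]; field_simp
    rw [this, show Real.pi * |κ.im| - (Real.log (2 * (|c| + 1)) + Real.pi * |κ.im|) =
      -Real.log (2 * (|c| + 1)) by ring, Real.exp_neg, Real.exp_log (by positivity)]
  refine Summable.of_nonneg_of_le (fun r => by positivity) (fun r => ?_)
    ((summable_geometric_of_lt_one (r := (1 / 2 : ℝ)) (by norm_num) (by norm_num)).mul_left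
      (K * Real.exp (Real.pi * |β.im| - β.re * L)))
  have hre : (β + κ * r).re = β.re + κ.re * r := by simp
  have him : (β + κ * r).im = β.im + κ.im * r := by simp
  have hr : (0 : ℝ) ≤ r := r.cast_nonneg
  have h1 := hK (β + κ * r) (by rw [hre]; positivity)
  rw [Real.log_exp, hre, him] at h1
  have h2 : Real.exp (Real.pi * |β.im + κ.im * r| - (β.re + κ.re * r) * L) ≤
      Real.exp (Real.pi * |β.im| - β.re * L) * (2 * (|c| + 1))⁻¹ ^ r := by
    rw [← hq, ← Real.exp_nat_mul, ← Real.exp_add, Real.exp_le_exp]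
    have := mul_le_mul_of_nonneg_left (abs_add_le β.im (κ.im * r)) Real.pi_pos.le
    rw [abs_mul, abs_of_nonneg hr] at this
    linarith
  calc |c| ^ r * ‖(Complex.Gamma (β + κ * r))⁻¹‖
      ≤ |c| ^ r * (K * (Real.exp (Real.pi * |β.im| - β.re * L) * (2 * (|c| + 1))⁻¹ ^ r)) := by
        gcongr
        exact h1.trans (by gcongr)
    _ = K * Real.exp (Real.pi * |β.im| - β.re * L) * (|c| * (2 * (|c| + 1))⁻¹) ^ r := by
        rw [mul_pow]; ring
    _ ≤ K * Real.exp (Real.pi * |β.im| - β.re * L) * (1 / 2) ^ r := by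
        gcongr
        rw [← div_eq_mul_inv, div_le_div_iff₀ (by positivity) (by norm_num)]
        linarith

lemma summable_norm_ascPochhammer_div_Gamma {α : ℂ} (hα : 0 < α.re) (γ : ℂ) {q : ℝ}
    (h0 : 0 ≤ q) (h1 : q < 1) :
    Summable fun s : ℕ => ‖(ascPochhammer ℂ s).eval γ * (Complex.Gamma (α + s))⁻¹‖ * q ^ s := by
  refine summable_of_ratio_norm_eventually_le (r := (1 + q) / 2) (by linarith) ?_
  have hq : 0 < 1 - q := by linarith
  -- The threshold solves q(‖γ‖ + s) ≤ s(1 + q)/2; the added 1 ensures s > 0.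
  filter_upwards [eventually_ge_atTop (⌈2 * q * ‖γ‖ / (1 - q)⌉₊ + 1)] with s hs
  have hs1 : 2 * q * ‖γ‖ / (1 - q) ≤ s :=
    (Nat.le_ceil _).trans (by exact_mod_cast (Nat.le_succ _).trans hs)
  have hs0 : (0 : ℝ) < s := by exact_mod_cast (by omega : 0 < s)
  rw [div_le_iff₀ hq] at hs1
  have hre : (α + s).re = α.re + s := by simp
  have hne : α + s ≠ 0 := fun h => by
    have := congrArg Complex.re h
    rw [hre, Complex.zero_re] at this
    linarith
  have hn : (s : ℝ) ≤ ‖α + s‖ := by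
    have := Complex.re_le_norm (α + s)
    rw [hre] at this
    linarith
  have hγ : ‖γ + s‖ ≤ ‖γ‖ + s := by simpa using norm_add_le γ (s : ℂ)
  rw [ascPochhammer_succ_eval, Nat.cast_succ, ← add_assoc, Complex.Gamma_add_one _ hne,
    Real.norm_of_nonneg (by positivity), Real.norm_of_nonneg (by positivity), pow_succ, mul_inv]
  simp only [norm_mul, norm_inv]
  have hpos : 0 < ‖α + s‖ := hs0.trans_le hn
  have key : ‖γ + s‖ * ‖α + s‖⁻¹ * q ≤ (1 + q) / 2 := by
    rw [mul_right_comm, ← div_eq_mul_inv, div_le_iff₀ hpos]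
    calc ‖γ + s‖ * q ≤ (‖γ‖ + s) * q := by gcongr
      _ ≤ (1 + q) / 2 * s := by linarith
      _ ≤ _ := by gcongr
  calc _ = (‖γ + s‖ * ‖α + s‖⁻¹ * q) *
        (‖(ascPochhammer ℂ s).eval γ‖ * ‖Complex.Gamma (α + s)‖⁻¹ * q ^ s) := by ring
    _ ≤ _ := by gcongr

lemma seriesTerm_eq (α β κ γ₁ γ₂ x y : ℂ) (s r : ℕ) :
    seriesTerm α β κ γ₁ γ₂ x y s r =
      (ascPochhammer ℂ (r + s)).eval γ₁ / ((r.factorial : ℂ) * (s.factorial : ℂ)) *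
        ((ascPochhammer ℂ s).eval γ₂ * (Complex.Gamma (α + s))⁻¹ * x ^ s) *
        ((y ^ κ) ^ r * (Complex.Gamma (β + κ * r))⁻¹) := by
  rw [seriesTerm, Complex.cpow_mul_nat, div_eq_mul_inv, div_eq_mul_inv, mul_inv, mul_inv]
  ring

/-- With |x| < b and a + b < 1, the coefficients (γ₁)_{r+s}/(r! s!) are O(a^(-r) b^(-s)). What
remains is a product of a series in |x|/b < 1 and one in ‖y^κ‖/a, the latter tamed by 1/Γ(β+κr). -/
lemma seriesConverges_of_norm_lt_one {α β κ : ℂ} (γ₁ γ₂ : ℂ) {x : ℂ} (y : ℂ) (hα : 0 < α.re)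
    (hβ : 0 < β.re) (hκ : 0 < κ.re) (hx : ‖x‖ < 1) : SeriesConverges α β κ γ₁ γ₂ x y := by
  set b := (1 + ‖x‖) / 2 with hb
  set a := (1 - b) / 2 with ha
  have hx0 := norm_nonneg x
  have hb0 : 0 < b := by positivity
  have hb1 : ‖x‖ < b := by rw [hb]; linarith
  have hb2 : b < 1 := by rw [hb]; linarith
  have ha0 : 0 < a := by rw [ha]; linarith
  obtain ⟨M, hM⟩ := exists_norm_ascPochhammer_add_le γ₁ ha0.le hb0.le (by rw [ha]; linarith)
  have h1 := summable_norm_ascPochhammer_div_Gamma hα γ₂ (q := ‖x‖ / b) (by positivity)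
    (by rwa [div_lt_one hb0])
  have h2 := summable_norm_pow_div_Gamma hβ hκ (‖y ^ κ‖ / a)
  refine Summable.of_nonneg_of_le (fun p => norm_nonneg _) (fun p => ?_)
    ((h1.mul_of_nonneg h2 (fun s => by positivity) fun r => by positivity).mul_left M)
  obtain ⟨s, r⟩ := p
  rw [seriesTerm_eq, abs_of_nonneg (by positivity)]
  simp only [norm_mul, norm_div, norm_pow, Complex.norm_natCast, div_pow]
  calc _ = (‖(ascPochhammer ℂ (r + s)).eval γ₁‖ / (r.factorial * s.factorial) * b ^ s * a ^ r) *
        (‖(ascPochhammer ℂ s).eval γ₂‖ * ‖(Complex.Gamma (α + s))⁻¹‖ * (‖x‖ ^ s / b ^ s) *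
          (‖y ^ κ‖ ^ r / a ^ r * ‖(Complex.Gamma (β + κ * r))⁻¹‖)) := by
        field_simp
    _ ≤ _ := by
        gcongr
        exact hM s r

lemma seriesConverges_of_neg_nat (α β κ γ₂ x y : ℂ) (n : ℕ) :
    SeriesConverges α β κ (-n) γ₂ x y := by
  refine summable_of_hasFiniteSupport ((Finset.range (n + 1) ×ˢ Finset.range (n + 1)).finite_toSet.subset
    fun p hp => ?_)
  by_contra h
  apply hp
  have hlt : n < p.2 + p.1 := by
    simp only [Finset.coe_product, Finset.coe_range, mem_prod, mem_Iio] at h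
    omega
  have : (ascPochhammer ℂ (p.2 + p.1)).eval (-(n : ℂ)) = 0 :=
    ascPochhammer_eval_neg_coe_nat_of_lt hlt
  simp [seriesTerm, this]

/-! ### Admissible radii and uniform bounds on the contours -/

/-- Modulus of `y ^ κ / w ^ κ` on the Hankel contour. -/
lemma norm_div_hankelPow_le {S : ℝ} (hS : 0 < S) (τ : ℝ) {κ : ℂ} (hκ : 0 ≤ κ.re) (c : ℂ) :
    ‖c / hankelPow S τ κ‖ ≤ ‖c‖ * Real.exp (Real.pi * |κ.im| - κ.re * Real.log S) := by
  rw [div_eq_mul_inv, ← hankelPow_neg, norm_mul]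
  gcongr
  exact norm_hankelPow_neg_le hS τ hκ

/-- Brings the second admissibility condition to the form |b/(1-a)| < 1 used by the binomial
expansions. -/
lemma mul_hankelPow_div_eq (c y : ℂ) (κ : ℂ) (R S σ τ : ℝ) :
    c * hankelPow S τ κ / (hankelPt R σ * (hankelPow S τ κ - y ^ κ)) =
      c / hankelPt R σ / (1 - y ^ κ / hankelPow S τ κ) := by
  have h1 := hankelPow_ne_zero S τ κ
  have h2 := hankelPt_ne_zero R σ
  rw [one_sub_div h1, div_div_eq_mul_div, div_mul_eq_mul_div, div_div]

lemma exists_admissibleRadii {κ : ℂ} (x y : ℂ) (hκ : 0 < κ.re) :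
    ∃ R S : ℝ → ℝ, AdmissibleRadii κ x y R S := by
  -- The choice of S = e^L forces |a| ≤ 1/2, hence |1-a| ≥ 1/2, while R > 2t|x| forces |b| < 1/2.
  set L := (Real.log (2 * (‖y ^ κ‖ + 1)) + Real.pi * |κ.im|) / κ.re with hL
  refine ⟨fun t => 2 * |t| * ‖x‖ + 1, fun _ => Real.exp L, fun t ht => ⟨by positivity,
    Real.exp_pos _, fun σ τ => ?_⟩⟩
  have hA : ‖y ^ κ / hankelPow (Real.exp L) τ κ‖ ≤ 1 / 2 := by
    refine (norm_div_hankelPow_le (Real.exp_pos L) τ hκ.le _).trans ?_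
    have : κ.re * L = Real.log (2 * (‖y ^ κ‖ + 1)) + Real.pi * |κ.im| := by
      rw [hL]; field_simp
    rw [Real.log_exp, this, show Real.pi * |κ.im| - (Real.log (2 * (‖y ^ κ‖ + 1)) +
      Real.pi * |κ.im|) = -Real.log (2 * (‖y ^ κ‖ + 1)) by ring, Real.exp_neg,
      Real.exp_log (by positivity), ← div_eq_mul_inv, div_le_div_iff₀ (by positivity) (by norm_num)]
    linarith
  have hR : 0 < 2 * |t| * ‖x‖ + 1 := by positivity
  refine ⟨by linarith, ?_⟩
  have h1 : 1 / 2 ≤ ‖1 - y ^ κ / hankelPow (Real.exp L) τ κ‖ := by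
    have := norm_sub_norm_le (1 : ℂ) (y ^ κ / hankelPow (Real.exp L) τ κ)
    rw [norm_one] at this
    linarith
  have h2 := le_hankelAbs (2 * |t| * ‖x‖ + 1) σ
  rw [mul_hankelPow_div_eq, norm_div, norm_div, norm_mul, norm_hankelPt hR, Complex.norm_real,
    Real.norm_eq_abs, div_div, div_lt_one (by have := hankelAbs_pos hR σ; positivity)]
  have h3 := mul_le_mul h2 h1 (by norm_num) (hankelAbs_pos hR σ).le
  linarith

/-- Outside a compact set the limit controls f; on the compact set the maximum is attained and is
below c. -/
lemma exists_uniform_lt {f : ℝ → ℝ} {L c : ℝ} (hf : Continuous f)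
    (hL : Tendsto f (cocompact ℝ) (𝓝 L)) (hLc : L < c) (h : ∀ τ, f τ < c) :
    ∃ q < c, ∀ τ, f τ ≤ q := by
  have hev := hL.eventually_lt_const (show L < (L + c) / 2 by linarith)
  obtain ⟨K, hK, hKs⟩ := mem_cocompact.1 hev
  rcases K.eq_empty_or_nonempty with rfl | hne
  · exact ⟨(L + c) / 2, by linarith, fun τ => (hKs (by simp)).le⟩
  obtain ⟨τ₀, -, hτ₀⟩ := hK.exists_isMaxOn hne hf.continuousOn
  refine ⟨max (f τ₀) ((L + c) / 2), max_lt (h τ₀) (by linarith), fun τ => ?_⟩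
  by_cases hτ : τ ∈ K
  · exact (hτ₀ hτ).trans (le_max_left _ _)
  · exact (show f τ < _ from hKs hτ).le.trans (le_max_right _ _)

lemma continuous_div_hankelPow {S : ℝ} (hS : 0 < S) (κ c : ℂ) :
    Continuous fun τ => c / hankelPow S τ κ :=
  continuous_const.div (continuous_hankelPow hS κ) fun τ => hankelPow_ne_zero S τ κ

lemma tendsto_div_hankelPow (S : ℝ) {κ : ℂ} (hκ : 0 < κ.re) (c : ℂ) :
    Tendsto (fun τ => c / hankelPow S τ κ) (cocompact ℝ) (𝓝 0) := by
  have h1 : Tendsto (hankelAbs S) (cocompact ℝ) atTop := by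
    refine tendsto_atTop_mono (fun τ => ?_)
      (tendsto_atTop_add_const_left _ (S - Real.pi) (tendsto_norm_cocompact_atTop (E := ℝ)))
    rw [hankelAbs, Real.norm_eq_abs]
    linarith [le_max_right 0 (|τ| - Real.pi)]
  have h2 : Tendsto (fun τ => ‖c‖ * (Real.exp (|κ.im| * Real.pi) *
      Real.exp (-(κ.re * Real.log (hankelAbs S τ))))) (cocompact ℝ) (𝓝 0) := by
    have := Real.tendsto_exp_neg_atTop_nhds_zero.comp
      ((Real.tendsto_log_atTop.comp h1).const_mul_atTop hκ)
    simpa [Function.comp_def] using (this.const_mul (Real.exp (|κ.im| * Real.pi))).const_mul ‖c‖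
  refine squeeze_zero_norm (fun τ => ?_) h2
  rw [div_eq_mul_inv, ← hankelPow_neg, norm_mul, norm_hankelPow, ← Real.exp_add]
  gcongr
  have : κ.im * hankelArg τ ≤ |κ.im| * Real.pi := (le_abs_self _).trans <| by
    rw [abs_mul]
    gcongr
    exact abs_hankelArg_le τ
  rw [Complex.neg_re, Complex.neg_im]
  linarith

/-- Along the contour `y ^ κ / w ^ κ` meets the positive half-axis. -/
lemma exists_div_hankelPow_eq_norm {S : ℝ} (hS : 0 < S) (κ : ℂ) {y : ℂ} (hy : y ≠ 0) :
    ∃ τ, y ^ κ / hankelPow S τ κ = (‖y ^ κ / hankelPow S τ κ‖ : ℂ) := by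
  have hpi := Real.pi_pos
  have hA : ∀ τ, y ^ κ / hankelPow S τ κ =
      Complex.exp (κ * (Complex.log y - hankelLog S τ)) := fun τ => by
    rw [Complex.cpow_def_of_ne_zero hy, hankelPow, ← Complex.exp_sub]
    ring_nf
  have real : ∀ (τ : ℝ) (k : ℤ), (κ * (Complex.log y - hankelLog S τ)).im = 2 * Real.pi * k →
      y ^ κ / hankelPow S τ κ = (‖y ^ κ / hankelPow S τ κ‖ : ℂ) := fun τ k hk => by
    rw [hA, Complex.norm_exp, Complex.ofReal_exp, Complex.exp_eq_exp_iff_exists_int]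
    refine ⟨k, ?_⟩
    conv_lhs => rw [← Complex.re_add_im (κ * (Complex.log y - hankelLog S τ)), hk]
    push_cast
    ring
  -- For real κ the point of the circle with the argument of y works.
  by_cases hb : κ.im = 0
  · refine ⟨y.arg, real _ 0 ?_⟩
    rw [hankelLog_of_mem S ⟨(Complex.neg_pi_lt_arg y).le, Complex.arg_le_pi y⟩]
    simp [hb, Complex.mul_im, Complex.log_im]
  -- On the outgoing ray the phase Re κ (arg y - π) + Im κ (log|y| - ℓ), with ℓ = log|w|, is
  -- unbounded. Setting it equal to 2πk determines ℓ; the sign and size of k are chosen so that e^ℓ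
  -- > S.
  obtain ⟨k, hk⟩ : ∃ k : ℤ,
      Real.log S < Real.log ‖y‖ + (κ.re * (y.arg - Real.pi) - 2 * Real.pi * k) / κ.im := by
    rcases lt_or_gt_of_ne hb with hb' | hb'
    · obtain ⟨k, hk⟩ := exists_int_gt
        ((κ.re * (y.arg - Real.pi) - (Real.log S - Real.log ‖y‖) * κ.im) / (2 * Real.pi))
      refine ⟨k, ?_⟩
      rw [div_lt_iff₀ (by positivity)] at hk
      rw [← sub_lt_iff_lt_add', lt_div_iff_of_neg hb']
      linarith
    · obtain ⟨k, hk⟩ := exists_int_lt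
        ((κ.re * (y.arg - Real.pi) - (Real.log S - Real.log ‖y‖) * κ.im) / (2 * Real.pi))
      refine ⟨k, ?_⟩
      rw [lt_div_iff₀ (by positivity)] at hk
      rw [← sub_lt_iff_lt_add', lt_div_iff₀ hb']
      linarith
  set ℓ := Real.log ‖y‖ + (κ.re * (y.arg - Real.pi) - 2 * Real.pi * k) / κ.im with hℓ
  have hS' : S < Real.exp ℓ := (Real.log_lt_iff_lt_exp hS).1 hk
  refine ⟨Real.exp ℓ - S + Real.pi, real _ k ?_⟩
  rw [hankelLog_of_gt S (by linarith),
    show S - Real.pi + (Real.exp ℓ - S + Real.pi) = Real.exp ℓ by ring, Real.log_exp]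
  simp only [Complex.mul_im, Complex.sub_im, Complex.sub_re, Complex.log_im, Complex.log_re,
    Complex.add_re, Complex.add_im, Complex.ofReal_re, Complex.ofReal_im, Complex.mul_re,
    Complex.I_re, Complex.I_im]
  rw [hℓ]
  field_simp
  ring

/-- The pointwise inequalities of `AdmissibleRadii` hold uniformly along the contours. -/
lemma exists_uniform_bound {κ c y : ℂ} {R S : ℝ} (hκ : 0 < κ.re) (hR : 0 < R) (hS : 0 < S)
    (h : ∀ σ τ, ‖y ^ κ / hankelPow S τ κ‖ < 1 ∧
      ‖c / hankelPt R σ / (1 - y ^ κ / hankelPow S τ κ)‖ < 1) :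
    ∃ q < 1, ∀ σ τ, ‖y ^ κ / hankelPow S τ κ‖ ≤ q ∧
      ‖c / hankelPt R σ / (1 - y ^ κ / hankelPow S τ κ)‖ ≤ q := by
  set A : ℝ → ℂ := fun τ => y ^ κ / hankelPow S τ κ with hA
  have hAc : Continuous A := continuous_div_hankelPow hS κ _
  have hA0 : Tendsto A (cocompact ℝ) (𝓝 0) := tendsto_div_hankelPow S hκ _
  have hA1 : ∀ τ, 1 - A τ ≠ 0 := fun τ h0 => by
    have := (h 0 τ).1
    change ‖A τ‖ < 1 at this
    rw [← sub_eq_zero.1 h0, norm_one] at this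
    exact lt_irrefl _ this
  -- The parameter 0 lies on the circle, where |u| is smallest and the second condition is
  -- strongest.
  have hR0 : ‖hankelPt R 0‖ = R := by
    rw [norm_hankelPt hR, hankelAbs, max_eq_left (by simp [Real.pi_pos.le]), add_zero]
  have hB : ∀ τ, ‖c‖ / R / ‖1 - A τ‖ < 1 := fun τ => by
    have := (h 0 τ).2
    rwa [norm_div, norm_div, hR0] at this
  -- As w → ∞ the quotient tends to ‖c‖/R, and passing to the limit would only give ≤ 1. Strictness
  -- comes from a point where y^κ/w^κ lies in [0, 1), since there ‖c‖/R < |1-a| ≤ 1.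
  have hlim : ‖c‖ / R < 1 := by
    obtain ⟨τ, hτ⟩ : ∃ τ, ‖1 - A τ‖ ≤ 1 := by
      by_cases hy : y = 0
      · have hκ0 : κ ≠ 0 := fun h0 => by simp [h0] at hκ
        exact ⟨0, by simp [hA, hy, Complex.zero_cpow hκ0]⟩
      · obtain ⟨τ, hτ⟩ := exists_div_hankelPow_eq_norm hS κ hy
        refine ⟨τ, ?_⟩
        have h1 : ‖A τ‖ < 1 := (h 0 τ).1
        have : 1 - A τ = ((1 - ‖A τ‖ : ℝ) : ℂ) := by
          rw [Complex.ofReal_sub, Complex.ofReal_one]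
          exact congrArg (1 - ·) hτ
        rw [this, Complex.norm_real, Real.norm_of_nonneg (by linarith)]
        linarith [norm_nonneg (A τ)]
    have := hB τ
    rw [div_lt_one (norm_pos_iff.2 (hA1 τ))] at this
    linarith
  obtain ⟨q₁, hq₁, h₁⟩ := exists_uniform_lt (L := 0) (c := 1) hAc.norm
    (by simpa using hA0.norm) one_pos fun τ => (h 0 τ).1
  obtain ⟨q₂, hq₂, h₂⟩ := exists_uniform_lt (f := fun τ => ‖c‖ / R / ‖1 - A τ‖) (L := ‖c‖ / R)
    (c := 1) (continuous_const.div (by fun_prop) fun τ => norm_ne_zero_iff.2 (hA1 τ))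
    (by
      have := (tendsto_const_nhds (x := ‖c‖ / R)).div
        ((tendsto_const_nhds (x := (1 : ℂ))).sub hA0).norm (by simp)
      simp only [sub_zero, norm_one, div_one] at this
      exact this) hlim hB
  refine ⟨max q₁ q₂, max_lt hq₁ hq₂, fun σ τ => ⟨(h₁ τ).trans (le_max_left _ _), ?_⟩⟩
  refine le_trans ?_ ((h₂ τ).trans (le_max_right _ _))
  rw [norm_div, norm_div, norm_hankelPt hR]
  gcongr
  exact le_hankelAbs R σ

/-! ### Termwise integration over the two contours -/

lemma hankelKernel_add_natCast (ρ : ℝ) (z : ℂ) (s : ℕ) (τ : ℝ) :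
    hankelKernel ρ (z + s) τ = hankelKernel ρ z τ * (1 / hankelPt ρ τ) ^ s := by
  rw [hankelKernel, hankelKernel, neg_add, hankelPow_add, hankelPow_neg ρ τ (s : ℂ),
    hankelPow_natCast, one_div, inv_pow]
  ring

lemma hankelKernel_add_mul_natCast (ρ : ℝ) (z κ : ℂ) (r : ℕ) (τ : ℝ) :
    hankelKernel ρ (z + κ * r) τ = hankelKernel ρ z τ * (1 / hankelPow ρ τ κ) ^ r := by
  rw [hankelKernel, hankelKernel, neg_add, hankelPow_add, hankelPow_neg ρ τ (κ * r),
    hankelPow_mul_natCast, one_div, inv_pow]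
  ring

/-- Termwise integration of the binomial series of `(1 - c / w ^ κ) ^ (-δ)`. -/
lemma hasSum_integral_one_sub_cpow {β κ : ℂ} (hβ : 0 < β.re) (hκ : 0 < κ.re) {S : ℝ} (hS : 0 < S)
    {c : ℂ} {q : ℝ} (hq : q < 1) (hc : ∀ τ, ‖c / hankelPow S τ κ‖ ≤ q) (δ : ℂ) :
    HasSum (fun r : ℕ => (ascPochhammer ℂ r).eval δ / (r.factorial : ℂ) * c ^ r *
        (2 * Real.pi * Complex.I / Complex.Gamma (β + κ * r)))
      (∫ τ, hankelKernel S β τ * (1 - c / hankelPow S τ κ) ^ (-δ)) := by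
  have hq0 : 0 ≤ q := (norm_nonneg _).trans (hc 0)
  have hs := summable_norm_binomialCoeff δ hq0 hq
  have hk := integrable_hankelKernel hS hβ.le
  have hm := measurable_hankelKernel hS β
  have hm2 := (continuous_div_hankelPow hS κ c).measurable
  have H := hasSum_integral_of_dominated_convergence (μ := volume)
    (F := fun (r : ℕ) τ => hankelKernel S β τ *
      ((ascPochhammer ℂ r).eval δ / (r.factorial : ℂ) * (c / hankelPow S τ κ) ^ r))
    (f := fun τ => hankelKernel S β τ * (1 - c / hankelPow S τ κ) ^ (-δ))
    (fun r τ => ‖hankelKernel S β τ‖ *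
      (‖(ascPochhammer ℂ r).eval δ / (r.factorial : ℂ)‖ * q ^ r))
    (fun r => by
      have : Measurable fun τ => hankelKernel S β τ *
        ((ascPochhammer ℂ r).eval δ / (r.factorial : ℂ) * (c / hankelPow S τ κ) ^ r) := by
        fun_prop
      exact this.aestronglyMeasurable)
    (fun r => ae_of_all _ fun τ => by
      rw [norm_mul, norm_mul, norm_pow]
      gcongr
      exact hc τ)
    (ae_of_all _ fun τ => hs.mul_left _)
    (by simpa only [tsum_mul_left] using hk.norm.mul_const _)
    (ae_of_all _ fun τ => (hasSum_one_sub_cpow δ ((hc τ).trans_lt hq)).mul_left _)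
  refine H.congr_fun fun r => ?_
  have hre : 0 < (β + κ * r).re := by
    have : (0 : ℝ) ≤ r := r.cast_nonneg
    simp
    positivity
  rw [← hankel_integral hS hre, ← integral_const_mul]
  refine integral_congr_ae (ae_of_all _ fun τ => ?_)
  simp only [hankelKernel_add_mul_natCast, div_pow]
  ring

/-- The `t`-independent part of the integrand along the two contours. -/
def contourIntegrand (α β κ γ y c : ℂ) (R S : ℝ) (p : ℝ × ℝ) : ℂ :=
  hankelKernel R α p.1 * hankelKernel S β p.2 *
    (1 - y ^ κ / hankelPow S p.2 κ - c / hankelPt R p.1) ^ (-γ)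

section Contour

variable {α β κ γ y c : ℂ} {R S q : ℝ}

lemma norm_contourIntegrand_le (hq : q < 1)
    (h : ∀ σ τ, ‖y ^ κ / hankelPow S τ κ‖ ≤ q ∧
      ‖c / hankelPt R σ / (1 - y ^ κ / hankelPow S τ κ)‖ ≤ q) (p : ℝ × ℝ) :
    ‖contourIntegrand α β κ γ y c R S p‖ ≤
      ‖hankelKernel R α p.1 * hankelKernel S β p.2‖ *
        ((∑' n : ℕ, ‖(ascPochhammer ℂ n).eval γ / (n.factorial : ℂ)‖ * q ^ n) *
        ∑' n : ℕ, ‖(ascPochhammer ℂ n).eval γ / (n.factorial : ℂ)‖ * q ^ n) := by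
  obtain ⟨h1, h2⟩ := h p.1 p.2
  have hq0 : 0 ≤ q := (norm_nonneg _).trans h1
  rw [contourIntegrand, norm_mul, one_sub_sub_cpow γ (h1.trans_lt hq) (h2.trans_lt hq)]
  refine mul_le_mul_of_nonneg_left ?_ (norm_nonneg _)
  rw [norm_mul]
  gcongr
  · exact norm_one_sub_cpow_le γ h1 hq
  · exact norm_one_sub_cpow_le γ h2 hq

lemma integrable_contourIntegrand (hα : 0 < α.re) (hβ : 0 < β.re) (hR : 0 < R) (hS : 0 < S)
    (hq : q < 1) (h : ∀ σ τ, ‖y ^ κ / hankelPow S τ κ‖ ≤ q ∧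
      ‖c / hankelPt R σ / (1 - y ^ κ / hankelPow S τ κ)‖ ≤ q) :
    Integrable (contourIntegrand α β κ γ y c R S) := by
  have hk := (integrable_hankelKernel hR hα.le).mul_prod (integrable_hankelKernel hS hβ.le)
  refine Integrable.mono' (hk.norm.mul_const _) ?_
    (ae_of_all _ (norm_contourIntegrand_le hq h))
  have m1 := measurable_hankelKernel hR α
  have m2 := measurable_hankelKernel hS β
  have m3 := (continuous_hankelPow hS κ).measurable
  have m4 := (continuous_hankelPt hR).measurable
  have : Measurable (contourIntegrand α β κ γ y c R S) := by
    unfold contourIntegrand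
    fun_prop
  exact this.aestronglyMeasurable

/-- Termwise integration over the two contours. -/
lemma hasSum_integral_contourIntegrand (hα : 0 < α.re) (hβ : 0 < β.re) (hκ : 0 < κ.re)
    (hR : 0 < R) (hS : 0 < S) (hq : q < 1)
    (h : ∀ σ τ, ‖y ^ κ / hankelPow S τ κ‖ ≤ q ∧
      ‖c / hankelPt R σ / (1 - y ^ κ / hankelPow S τ κ)‖ ≤ q) :
    HasSum (fun s : ℕ => ∑' r : ℕ, -(4 * (Real.pi : ℂ) ^ 2) *
        ((ascPochhammer ℂ (r + s)).eval γ / ((r.factorial : ℂ) * (s.factorial : ℂ)) *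
        ((Complex.Gamma (α + s))⁻¹ * c ^ s) * ((y ^ κ) ^ r * (Complex.Gamma (β + κ * r))⁻¹)))
      (∫ p, contourIntegrand α β κ γ y c R S p) := by
  have hq0 : 0 ≤ q := (norm_nonneg _).trans (h 0 0).1
  have hkk := (integrable_hankelKernel hR hα.le).mul_prod (integrable_hankelKernel hS hβ.le)
  have m1 := measurable_hankelKernel hR α
  have m2 := measurable_hankelKernel hS β
  have m3 := (continuous_hankelPow hS κ).measurable
  have m4 := (continuous_hankelPt hR).measurable
  set N := ∑' n : ℕ, ‖(ascPochhammer ℂ n).eval γ / (n.factorial : ℂ)‖ * q ^ n with hN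
  have hs := summable_norm_binomialCoeff γ hq0 hq
  -- The s-th term of the expansion in b is a function of u times a function of w, so its double
  -- integral splits.
  set F : ℕ → ℝ × ℝ → ℂ := fun s p =>
    (hankelKernel R α p.1 * ((ascPochhammer ℂ s).eval γ / (s.factorial : ℂ) *
      (c / hankelPt R p.1) ^ s)) *
    (hankelKernel S β p.2 * (1 - y ^ κ / hankelPow S p.2 κ) ^ (-(γ + s))) with hF
  have H := hasSum_integral_of_dominated_convergence (μ := (volume : Measure (ℝ × ℝ)))
    (F := F) (f := contourIntegrand α β κ γ y c R S)
    (fun s p => ‖hankelKernel R α p.1 * hankelKernel S β p.2‖ * N *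
      (‖(ascPochhammer ℂ s).eval γ / (s.factorial : ℂ)‖ * q ^ s))
    (fun s => by
      have : Measurable (F s) := by
        simp only [hF]
        fun_prop
      exact this.aestronglyMeasurable)
    (fun s => ae_of_all _ fun p => by
      obtain ⟨h1, h2⟩ := h p.1 p.2
      have n1 : 1 - y ^ κ / hankelPow S p.2 κ ≠ 0 := fun h0 => by
        rw [← sub_eq_zero.1 h0, norm_one] at h1
        linarith
      have e : F s p = hankelKernel R α p.1 * hankelKernel S β p.2 *
          (1 - y ^ κ / hankelPow S p.2 κ) ^ (-γ) *
          ((ascPochhammer ℂ s).eval γ / (s.factorial : ℂ) *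
            (c / hankelPt R p.1 / (1 - y ^ κ / hankelPow S p.2 κ)) ^ s) := by
        simp only [hF]
        rw [neg_add, Complex.cpow_add _ _ n1, Complex.cpow_neg _ (s : ℂ), Complex.cpow_natCast,
          div_pow _ (1 - y ^ κ / hankelPow S p.2 κ)]
        ring
      rw [e, norm_mul, norm_mul _ ((1 - y ^ κ / hankelPow S p.2 κ) ^ (-γ)),
        norm_mul (_ / _) (_ ^ s), norm_pow]
      gcongr
      exact norm_one_sub_cpow_le γ h1 hq)
    (ae_of_all _ fun p => hs.mul_left _)
    (by
      simp only [tsum_mul_left]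
      exact (hkk.norm.mul_const N).mul_const _)
    (ae_of_all _ fun p => by
      obtain ⟨h1, h2⟩ := h p.1 p.2
      refine ((hasSum_one_sub_sub_cpow γ (h1.trans_lt hq) (h2.trans_lt hq)).mul_left
        (hankelKernel R α p.1 * hankelKernel S β p.2)).congr_fun fun s => ?_
      simp only [hF]
      ring)
  refine H.congr_fun fun s => ?_
  have hre : 0 < (α + s).re := by
    have : (0 : ℝ) ≤ s := s.cast_nonneg
    simp
    positivity
  have hu : ∫ σ, hankelKernel R α σ * ((ascPochhammer ℂ s).eval γ / (s.factorial : ℂ) *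
      (c / hankelPt R σ) ^ s) = (ascPochhammer ℂ s).eval γ / (s.factorial : ℂ) * c ^ s *
        (2 * Real.pi * Complex.I / Complex.Gamma (α + s)) := by
    rw [← hankel_integral hR hre, ← integral_const_mul]
    refine integral_congr_ae (ae_of_all _ fun σ => ?_)
    simp only [hankelKernel_add_natCast, div_pow]
    ring
  have hw := (hasSum_integral_one_sub_cpow hβ hκ hS hq (fun τ => (h 0 τ).1) (γ + s)).mul_left
    ((ascPochhammer ℂ s).eval γ / (s.factorial : ℂ) * c ^ s *
        (2 * Real.pi * Complex.I / Complex.Gamma (α + s)))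
  simp only [hF]
  have hp := integral_prod_mul (μ := (volume : Measure ℝ)) (ν := (volume : Measure ℝ))
    (fun σ => hankelKernel R α σ *
      ((ascPochhammer ℂ s).eval γ / (s.factorial : ℂ) * (c / hankelPt R σ) ^ s))
    (fun τ => hankelKernel S β τ * (1 - y ^ κ / hankelPow S τ κ) ^ (-(γ + s)))
  rw [Measure.volume_eq_prod]
  refine Eq.trans ?_ hp.symm
  rw [hu, ← hw.tsum_eq]
  refine tsum_congr fun r => ?_
  -- The two expansions combine through (γ)_s (γ+s)_r = (γ)_{s+r}, and (2πi)² = -4π².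
  rw [add_comm r s, ascPochhammer_eval_add]
  simp only [div_eq_mul_inv, mul_inv]
  linear_combination (-(4 * (Real.pi : ℂ) ^ 2) * (ascPochhammer ℂ s).eval γ *
    (ascPochhammer ℂ r).eval (γ + s) * (r.factorial : ℂ)⁻¹ * (s.factorial : ℂ)⁻¹ *
    (Complex.Gamma (α + s))⁻¹ * c ^ s * (y ^ κ) ^ r * (Complex.Gamma (β + κ * r))⁻¹) *
    Complex.I_sq

end Contour

/-! ### The Laplace integral in t -/

/-- Pointwise summability makes the sum a limit of finite sums, hence measurable; Tonelli bounds its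
norm. -/
lemma integrable_tsum_of_summable_integral_norm {ι X : Type*} [Countable ι] [MeasurableSpace X]
    {μ : Measure X} {F : ι → X → ℂ} (hF : ∀ i, Integrable (F i) μ)
    (hsum : Summable fun i => ∫ a, ‖F i a‖ ∂μ) (hpt : ∀ᵐ a ∂μ, Summable fun i => F i a) :
    Integrable (fun a => ∑' i, F i a) μ := by
  refine ⟨aestronglyMeasurable_of_tendsto_ae atTop
    (f := fun (u : Finset ι) a => ∑ i ∈ u, F i a) (fun u =>
      Finset.aestronglyMeasurable_fun_sum u fun i _ => (hF i).1)
    (hpt.mono fun a ha => ha.hasSum), ?_⟩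
  have h1 : ∫⁻ a, ‖∑' i, F i a‖ₑ ∂μ ≤ ∑' i, ∫⁻ a, ‖F i a‖ₑ ∂μ := by
    rw [← lintegral_tsum fun i => (hF i).1.enorm]
    exact lintegral_mono fun a => enorm_tsum_le_tsum_enorm
  refine h1.trans_lt ?_
  simp_rw [← fun i => ofReal_integral_norm_eq_lintegral_enorm (hF i)]
  exact hsum.tsum_ofReal_lt_top

/-- Integrability of the density `t ^ (z - 1) e ^ (-t)` of the Gamma integral. -/
lemma integrableOn_cpow_mul_exp_neg {z : ℂ} (hz : 0 < z.re) :
    IntegrableOn (fun t : ℝ => (t : ℂ) ^ (z - 1) * Complex.exp (-t)) (Ioi 0) := by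
  refine (Complex.GammaIntegral_convergent hz).congr_fun (fun t _ => ?_) measurableSet_Ioi
  simp only [Complex.ofReal_exp, Complex.ofReal_neg]
  ring

lemma integral_cpow_mul_exp_neg {z : ℂ} (hz : 0 < z.re) :
    ∫ t in Ioi (0 : ℝ), (t : ℂ) ^ (z - 1) * Complex.exp (-t) = Complex.Gamma z := by
  rw [Complex.Gamma_eq_integral hz, Complex.GammaIntegral]
  refine setIntegral_congr_fun measurableSet_Ioi fun t _ => ?_
  simp only [Complex.ofReal_exp, Complex.ofReal_neg]
  ring

lemma integral_norm_cpow_mul_exp_neg {z : ℂ} (hz : 0 < z.re) :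
    ∫ t in Ioi (0 : ℝ), ‖(t : ℂ) ^ (z - 1) * Complex.exp (-t)‖ = Real.Gamma z.re := by
  rw [Real.Gamma_eq_integral hz]
  refine setIntegral_congr_fun measurableSet_Ioi fun t ht => ?_
  simp only [norm_mul, Complex.norm_cpow_eq_rpow_re_of_pos ht, Complex.norm_exp]
  simp [mul_comm]

lemma cpow_sub_one_mul_pow {t : ℝ} (ht : 0 < t) (z : ℂ) (s : ℕ) :
    (t : ℂ) ^ (z - 1) * (t : ℂ) ^ s = (t : ℂ) ^ (z + s - 1) := by
  rw [show z + s - 1 = z - 1 + s by ring, Complex.cpow_add _ _ (by exact_mod_cast ht.ne'),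
    Complex.cpow_natCast]

/-- Each factor satisfies Re γ + j ≤ |γ + j|. Thus taking absolute values under the Gamma integral
costs only a constant compared with |(γ₂)_s|. -/
lemma Gamma_re_add_natCast_le {γ : ℂ} (hγ : 0 < γ.re) (s : ℕ) :
    Real.Gamma (γ.re + s) ≤ Real.Gamma γ.re * ‖(ascPochhammer ℂ s).eval γ‖ := by
  induction s with
  | zero => simp
  | succ s ih =>
    have hs : (0 : ℝ) ≤ s := s.cast_nonneg
    have h0 : 0 < γ.re + s := by positivity
    have h1 : γ.re + s ≤ ‖γ + s‖ := by simpa using Complex.re_le_norm (γ + s)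
    rw [Nat.cast_succ, ← add_assoc, Real.Gamma_add_one h0.ne', ascPochhammer_succ_eval, norm_mul,
      mul_comm, ← mul_assoc]
    have := (Real.Gamma_pos_of_pos h0).le
    gcongr

/-- The decay bound for 1/Γ with contour radius t. -/
lemma exists_pow_le_mul_Gamma {g t : ℝ} (hg : 0 < g) (ht : 0 < t) :
    ∃ K : ℝ, 0 ≤ K ∧ ∀ s : ℕ, t ^ s ≤ K * Real.Gamma (g + s) := by
  obtain ⟨K, hK0, hK⟩ := exists_norm_inv_Gamma_le ht
  refine ⟨K * Real.exp (-(g * Real.log t)), by positivity, fun s => ?_⟩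
  have h0 : 0 < g + s := by positivity
  have h := hK ((g + s : ℝ) : ℂ) (by simpa using h0)
  have hG := Real.Gamma_pos_of_pos h0
  rw [Complex.Gamma_ofReal, norm_inv, Complex.norm_real, Real.norm_of_nonneg hG.le,
    Complex.ofReal_im, Complex.ofReal_re, abs_zero, mul_zero, zero_sub, add_mul, neg_add,
    Real.exp_add, inv_le_iff_one_le_mul₀ hG] at h
  have e : Real.exp (-(s * Real.log t)) * t ^ s = 1 := by
    rw [Real.exp_neg, Real.exp_nat_mul, Real.exp_log ht]
    exact inv_mul_cancel₀ (pow_pos ht s).ne'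
  calc t ^ s = 1 * t ^ s := (one_mul _).symm
    _ ≤ K * (Real.exp (-(g * Real.log t)) * Real.exp (-(s * Real.log t))) *
        Real.Gamma (g + s) * t ^ s := by gcongr
    _ = K * Real.exp (-(g * Real.log t)) * Real.Gamma (g + s) *
        (Real.exp (-(s * Real.log t)) * t ^ s) := by ring
    _ = _ := by rw [e, mul_one]

/-- The coefficient of the double series without the factor `(γ₂)_s`. -/
def reducedTerm (α β κ γ x y : ℂ) (p : ℕ × ℕ) : ℂ :=
  (ascPochhammer ℂ (p.2 + p.1)).eval γ / ((p.2.factorial : ℂ) * (p.1.factorial : ℂ)) *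
    ((Complex.Gamma (α + p.1))⁻¹ * x ^ p.1) * ((y ^ κ) ^ p.2 * (Complex.Gamma (β + κ * p.2))⁻¹)

lemma seriesTerm_eq_reducedTerm (α β κ γ₁ γ₂ x y : ℂ) (p : ℕ × ℕ) :
    seriesTerm α β κ γ₁ γ₂ x y p.1 p.2 =
      (ascPochhammer ℂ p.1).eval γ₂ * reducedTerm α β κ γ₁ x y p := by
  rw [seriesTerm_eq, reducedTerm]
  ring

lemma reducedTerm_mul (α β κ γ x y : ℂ) (t : ℂ) (p : ℕ × ℕ) :
    reducedTerm α β κ γ (t * x) y p = t ^ p.1 * reducedTerm α β κ γ x y p := by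
  simp only [reducedTerm, mul_pow]
  ring

lemma jkmlIntegrand_eq (α β κ γ₁ γ₂ x y : ℂ) (R S t σ τ : ℝ) :
    jkmlIntegrand α β κ γ₁ γ₂ x y R S t σ τ =
      (t : ℂ) ^ (γ₂ - 1) * Complex.exp (-t) * contourIntegrand α β κ γ₁ y (t * x) R S (σ, τ) := by
  rw [jkmlIntegrand, contourIntegrand, hankelKernel, hankelKernel, sub_eq_add_neg _ (t : ℂ),
    Complex.exp_add, Complex.exp_add]
  ring

section Main

variable {α β κ γ₁ γ₂ x y : ℂ}

/-- The summand of index `p` after the contour integrations, as a function of `t`. -/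
def laplaceTerm (α β κ γ₁ γ₂ x y : ℂ) (p : ℕ × ℕ) (t : ℝ) : ℂ :=
  -(4 * (Real.pi : ℂ) ^ 2) * reducedTerm α β κ γ₁ x y p *
    ((t : ℂ) ^ (γ₂ + p.1 - 1) * Complex.exp (-t))

lemma re_add_natCast_pos (hγ : 0 < γ₂.re) (s : ℕ) : 0 < (γ₂ + s).re := by
  have : (0 : ℝ) ≤ s := s.cast_nonneg
  simp only [Complex.add_re, Complex.natCast_re]
  positivity

lemma integrableOn_laplaceTerm (hγ : 0 < γ₂.re) (p : ℕ × ℕ) :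
    IntegrableOn (laplaceTerm α β κ γ₁ γ₂ x y p) (Ioi 0) :=
  (integrableOn_cpow_mul_exp_neg (re_add_natCast_pos hγ p.1)).const_mul _

lemma integral_laplaceTerm (hγ : 0 < γ₂.re) (p : ℕ × ℕ) :
    ∫ t in Ioi (0 : ℝ), laplaceTerm α β κ γ₁ γ₂ x y p t =
      -(4 * (Real.pi : ℂ) ^ 2) * Complex.Gamma γ₂ * seriesTerm α β κ γ₁ γ₂ x y p.1 p.2 := by
  simp only [laplaceTerm]
  rw [integral_const_mul, integral_cpow_mul_exp_neg (re_add_natCast_pos hγ p.1),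
    Gamma_add_natCast hγ, seriesTerm_eq_reducedTerm]
  ring

lemma summable_integral_norm_laplaceTerm (hγ : 0 < γ₂.re)
    (hs : SeriesConverges α β κ γ₁ γ₂ x y) :
    Summable fun p => ∫ t in Ioi (0 : ℝ), ‖laplaceTerm α β κ γ₁ γ₂ x y p t‖ := by
  refine Summable.of_nonneg_of_le (fun p => integral_nonneg fun t => norm_nonneg _) (fun p => ?_)
    (Summable.mul_left (‖(-(4 * (Real.pi : ℂ) ^ 2))‖ * Real.Gamma γ₂.re) hs)
  simp only [laplaceTerm, norm_mul _ (_ * Complex.exp _)]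
  rw [integral_const_mul, integral_norm_cpow_mul_exp_neg (re_add_natCast_pos hγ p.1),
    seriesTerm_eq_reducedTerm, norm_mul, norm_mul]
  calc _ ≤ ‖(-(4 * (Real.pi : ℂ) ^ 2))‖ * ‖reducedTerm α β κ γ₁ x y p‖ *
        (Real.Gamma γ₂.re * ‖(ascPochhammer ℂ p.1).eval γ₂‖) := by
        gcongr
        simpa using Gamma_re_add_natCast_le hγ p.1
    _ = _ := by ring

/-- For fixed t, t^s is O(Γ(Re γ₂ + s)), hence O(|(γ₂)_s|), and the double series is a majorant. -/
lemma summable_laplaceTerm (hγ : 0 < γ₂.re) (hs : SeriesConverges α β κ γ₁ γ₂ x y) {t : ℝ}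
    (ht : 0 < t) : Summable fun p => laplaceTerm α β κ γ₁ γ₂ x y p t := by
  obtain ⟨K, hK0, hK⟩ := exists_pow_le_mul_Gamma hγ ht
  set C := ‖(-(4 * (Real.pi : ℂ) ^ 2)) * ((t : ℂ) ^ (γ₂ - 1) * Complex.exp (-t))‖ with hC
  refine Summable.of_norm_bounded (Summable.mul_left (C * (K * Real.Gamma γ₂.re)) hs) fun p => ?_
  have e : laplaceTerm α β κ γ₁ γ₂ x y p t =
      (-(4 * (Real.pi : ℂ) ^ 2)) * ((t : ℂ) ^ (γ₂ - 1) * Complex.exp (-t)) *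
        ((t : ℂ) ^ p.1 * reducedTerm α β κ γ₁ x y p) := by
    rw [laplaceTerm, ← cpow_sub_one_mul_pow ht]
    ring
  rw [e, norm_mul, ← hC, norm_mul, norm_pow, Complex.norm_real, Real.norm_of_nonneg ht.le,
    seriesTerm_eq_reducedTerm, norm_mul]
  calc C * (t ^ p.1 * ‖reducedTerm α β κ γ₁ x y p‖) ≤
      C * (K * (Real.Gamma γ₂.re * ‖(ascPochhammer ℂ p.1).eval γ₂‖) *
        ‖reducedTerm α β κ γ₁ x y p‖) := by
        gcongr
        refine (hK p.1).trans ?_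
        gcongr
        exact Gamma_re_add_natCast_le hγ p.1
    _ = _ := by ring

lemma exists_uniform_bound_of_admissible (hκ : 0 < κ.re) {R S : ℝ → ℝ}
    (hRS : AdmissibleRadii κ x y R S) {t : ℝ} (ht : 0 < t) :
    0 < R t ∧ 0 < S t ∧ ∃ q < 1, ∀ σ τ, ‖y ^ κ / hankelPow (S t) τ κ‖ ≤ q ∧
      ‖t * x / hankelPt (R t) σ / (1 - y ^ κ / hankelPow (S t) τ κ)‖ ≤ q := by
  obtain ⟨hR, hS, h⟩ := hRS t ht
  refine ⟨hR, hS, exists_uniform_bound hκ hR hS fun σ τ => ⟨(h σ τ).1, ?_⟩⟩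
  rw [← mul_hankelPow_div_eq]
  exact (h σ τ).2

lemma integrable_jkmlIntegrand (hα : 0 < α.re) (hβ : 0 < β.re) (hκ : 0 < κ.re) {R S : ℝ → ℝ}
    (hRS : AdmissibleRadii κ x y R S) {t : ℝ} (ht : 0 < t) :
    Integrable fun p : ℝ × ℝ => jkmlIntegrand α β κ γ₁ γ₂ x y (R t) (S t) t p.1 p.2 := by
  obtain ⟨hR, hS, q, hq, h⟩ := exists_uniform_bound_of_admissible hκ hRS ht
  simp only [jkmlIntegrand_eq]
  exact (integrable_contourIntegrand hα hβ hR hS hq h).const_mul _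

/-- The contour integrals give an iterated sum; summability at this t regroups it over pairs. The
right side no longer involves the radii. -/
lemma integral_jkmlIntegrand (hα : 0 < α.re) (hβ : 0 < β.re) (hκ : 0 < κ.re) (hγ : 0 < γ₂.re)
    (hs : SeriesConverges α β κ γ₁ γ₂ x y) {R S : ℝ → ℝ} (hRS : AdmissibleRadii κ x y R S)
    {t : ℝ} (ht : 0 < t) :
    ∫ σ, ∫ τ, jkmlIntegrand α β κ γ₁ γ₂ x y (R t) (S t) t σ τ =
      ∑' p, laplaceTerm α β κ γ₁ γ₂ x y p t := by
  obtain ⟨hR, hS, q, hq, h⟩ := exists_uniform_bound_of_admissible hκ hRS ht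
  have hi := integrable_jkmlIntegrand (γ₁ := γ₁) (γ₂ := γ₂) hα hβ hκ hRS ht
  rw [Measure.volume_eq_prod] at hi
  have hp := integral_prod _ hi
  simp only at hp
  rw [← hp, ← Measure.volume_eq_prod]
  simp only [jkmlIntegrand_eq, integral_const_mul]
  rw [← (hasSum_integral_contourIntegrand hα hβ hκ hR hS hq h).tsum_eq,
    (summable_laplaceTerm hγ hs ht).tsum_prod, ← tsum_mul_left]
  refine tsum_congr fun s => ?_
  rw [← tsum_mul_left]
  refine tsum_congr fun r => ?_
  have := reducedTerm_mul α β κ γ₁ x y t (s, r)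
  rw [laplaceTerm, ← cpow_sub_one_mul_pow ht]
  simp only [reducedTerm] at this ⊢
  rw [this]
  ring

lemma integrableOn_integral_jkmlIntegrand (hα : 0 < α.re) (hβ : 0 < β.re) (hκ : 0 < κ.re)
    (hγ : 0 < γ₂.re) (hs : SeriesConverges α β κ γ₁ γ₂ x y) {R S : ℝ → ℝ}
    (hRS : AdmissibleRadii κ x y R S) :
    IntegrableOn (fun t : ℝ => ∫ σ, ∫ τ, jkmlIntegrand α β κ γ₁ γ₂ x y (R t) (S t) t σ τ)
      (Ioi 0) := by
  have h := integrable_tsum_of_summable_integral_norm (μ := volume.restrict (Ioi (0 : ℝ)))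
    (fun p => integrableOn_laplaceTerm (α := α) (β := β) (κ := κ) (γ₁ := γ₁) (x := x) (y := y) hγ p)
    (summable_integral_norm_laplaceTerm hγ hs)
    ((ae_restrict_mem measurableSet_Ioi).mono fun t ht => summable_laplaceTerm hγ hs ht)
  exact IntegrableOn.congr_fun h
    (fun t ht => (integral_jkmlIntegrand hα hβ hκ hγ hs hRS ht).symm) measurableSet_Ioi

/-- Summable L¹ norms allow termwise integration in t, which restores the factor (γ₂)_s Γ(γ₂). -/
theorem jkml_eq_integral (hα : 0 < α.re) (hβ : 0 < β.re) (hκ : 0 < κ.re)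
    (hγ : 0 < γ₂.re) (hs : SeriesConverges α β κ γ₁ γ₂ x y) {R S : ℝ → ℝ}
    (hRS : AdmissibleRadii κ x y R S) :
    jkml α β κ γ₁ γ₂ x y = -1 / (4 * (Real.pi : ℂ) ^ 2 * Complex.Gamma γ₂) *
      ∫ t in Ioi (0 : ℝ), ∫ σ : ℝ, ∫ τ : ℝ,
        jkmlIntegrand α β κ γ₁ γ₂ x y (R t) (S t) t σ τ := by
  rw [setIntegral_congr_fun measurableSet_Ioi
    (fun t ht => integral_jkmlIntegrand hα hβ hκ hγ hs hRS ht)]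
  have H := hasSum_integral_of_summable_integral_norm (μ := volume.restrict (Ioi (0 : ℝ)))
    (fun p => integrableOn_laplaceTerm (α := α) (β := β) (κ := κ) (γ₁ := γ₁) (x := x) (y := y) hγ p)
    (summable_integral_norm_laplaceTerm hγ hs)
  rw [← H.tsum_eq]
  simp only [integral_laplaceTerm hγ]
  have hsum : Summable fun p : ℕ × ℕ => seriesTerm α β κ γ₁ γ₂ x y p.1 p.2 := hs.of_norm
  rw [tsum_mul_left, jkml, hsum.tsum_prod]
  have hG := Complex.Gamma_ne_zero_of_re_pos hγ
  have hpi : (Real.pi : ℂ) ≠ 0 := by exact_mod_cast Real.pi_ne_zero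
  field_simp

end Main

/-! ### The Jacobi–Konhauser polynomials -/

lemma ascPochhammer_eval_neg_natCast_div_factorial (n m : ℕ) :
    (ascPochhammer ℂ m).eval (-(n : ℂ)) / (m.factorial : ℂ) = (-1) ^ m * (n.choose m : ℂ) := by
  rw [ascPochhammer_eval_neg_eq_descPochhammer, descPochhammer_eval_eq_descFactorial,
    Nat.descFactorial_eq_factorial_mul_choose]
  have : (m.factorial : ℂ) ≠ 0 := by exact_mod_cast m.factorial_ne_zero
  push_cast
  field_simp

lemma one_sub_pow_eq_sum (n : ℕ) (z : ℂ) :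
    (1 - z) ^ n = ∑ m ∈ Finset.range (n + 1),
      (ascPochhammer ℂ m).eval (-(n : ℂ)) / (m.factorial : ℂ) * z ^ m := by
  rw [show 1 - z = -z + 1 by ring, add_pow]
  refine Finset.sum_congr rfl fun m _ => ?_
  rw [ascPochhammer_eval_neg_natCast_div_factorial, neg_pow]
  ring

/-- The index set `{(s, r) | s + r ≤ n}`. -/
def triangle (n : ℕ) : Finset (Σ _ : ℕ, ℕ) :=
  (Finset.range (n + 1)).sigma fun s => Finset.range (n - s + 1)

lemma one_sub_sub_pow_eq_sum (n : ℕ) (a b : ℂ) :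
    (1 - a - b) ^ n = ∑ p ∈ triangle n,
      (ascPochhammer ℂ (p.1 + p.2)).eval (-(n : ℂ)) / ((p.1.factorial : ℂ) * (p.2.factorial : ℂ)) *
        b ^ p.1 * a ^ p.2 := by
  rw [triangle, Finset.sum_sigma, show 1 - a - b = -b + (1 - a) by ring, add_pow]
  refine Finset.sum_congr rfl fun s hs => ?_
  have hsn : s ≤ n := Nat.lt_succ_iff.1 (Finset.mem_range.1 hs)
  rw [one_sub_pow_eq_sum, Finset.mul_sum, Finset.sum_mul]
  refine Finset.sum_congr rfl fun r _ => ?_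
  have h := ascPochhammer_eval_neg_natCast_div_factorial n s
  have hs0 : (s.factorial : ℂ) ≠ 0 := by exact_mod_cast s.factorial_ne_zero
  rw [div_eq_iff hs0] at h
  simp only
  -- The inner binomial has exponent n - s, and (-n)_s (-(n-s))_r = (-n)_{s+r}.
  rw [ascPochhammer_eval_add, h, Nat.cast_sub hsn, neg_sub, sub_eq_neg_add, neg_pow b]
  field_simp

section Poly

variable {κ n : ℕ} {α β x y : ℂ}

/-- The coefficient of the Laplace integrand of index `(s, r)`. -/
def polyCoeff (κ n : ℕ) (x y : ℂ) (p : Σ _ : ℕ, ℕ) : ℂ :=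
  (ascPochhammer ℂ (p.1 + p.2)).eval (-(n : ℂ)) / ((p.1.factorial : ℂ) * (p.2.factorial : ℂ)) *
    ((1 - x) / 2) ^ p.1 * y ^ (κ * p.2)

/-- The powers of 1/u and 1/w^κ are absorbed into the kernel parameters, so each summand is a
product of two Hankel integrands. -/
lemma jkPolyIntegrand_eq_sum (R S t σ τ : ℝ) :
    jkPolyIntegrand κ n α β x y R S t σ τ =
      ∑ p ∈ triangle n, (t : ℂ) ^ (α + β + n) * Complex.exp (-t) * (t : ℂ) ^ p.1 *
        polyCoeff κ n x y p *
        (hankelKernel R (1 + α + p.1) σ * hankelKernel S (1 + β + κ * p.2) τ) := by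
  rw [jkPolyIntegrand, one_sub_sub_pow_eq_sum, Finset.mul_sum, Finset.sum_mul]
  refine Finset.sum_congr rfl fun p _ => ?_
  rw [hankelKernel_add_natCast, hankelKernel_add_mul_natCast, hankelKernel, hankelKernel,
    hankelPow_natCast, polyCoeff, sub_eq_add_neg _ (t : ℂ), Complex.exp_add, Complex.exp_add,
    pow_mul]
  simp only [div_eq_mul_inv, mul_pow, one_mul, inv_pow]
  ring

lemma re_one_add_add_natCast_pos (hα : -1 < α.re) (s : ℕ) : 0 < (1 + α + s).re := by
  have : (0 : ℝ) ≤ s := s.cast_nonneg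
  simp only [Complex.add_re, Complex.one_re, Complex.natCast_re]
  linarith

lemma re_one_add_add_mul_natCast_pos (hβ : -1 < β.re) (κ r : ℕ) :
    0 < (1 + β + (κ : ℂ) * r).re := by
  have := re_one_add_add_natCast_pos hβ (κ * r)
  rwa [Nat.cast_mul] at this

lemma integrable_mul_hankelKernel (hα : -1 < α.re) (hβ : -1 < β.re) {R S : ℝ} (hR : 0 < R)
    (hS : 0 < S) (p : Σ _ : ℕ, ℕ) :
    Integrable fun z : ℝ × ℝ =>
      hankelKernel R (1 + α + p.1) z.1 * hankelKernel S (1 + β + κ * p.2) z.2 :=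
  (integrable_hankelKernel hR (re_one_add_add_natCast_pos hα _).le).mul_prod
    (integrable_hankelKernel hS (re_one_add_add_mul_natCast_pos hβ _ _).le)

lemma integrable_jkPolyIntegrand (hα : -1 < α.re) (hβ : -1 < β.re) {R S : ℝ} (hR : 0 < R)
    (hS : 0 < S) (t : ℝ) :
    Integrable fun z : ℝ × ℝ => jkPolyIntegrand κ n α β x y R S t z.1 z.2 := by
  simp only [jkPolyIntegrand_eq_sum]
  exact integrable_finsetSum _ fun p _ => (integrable_mul_hankelKernel hα hβ hR hS p).const_mul _

lemma integral_jkPolyIntegrand (hα : -1 < α.re) (hβ : -1 < β.re) {R S : ℝ} (hR : 0 < R)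
    (hS : 0 < S) {t : ℝ} (ht : 0 < t) :
    ∫ σ, ∫ τ, jkPolyIntegrand κ n α β x y R S t σ τ =
      ∑ p ∈ triangle n, -(4 * (Real.pi : ℂ) ^ 2) * polyCoeff κ n x y p *
        ((Complex.Gamma (1 + α + p.1))⁻¹ * (Complex.Gamma (1 + β + κ * p.2))⁻¹) *
        ((t : ℂ) ^ (1 + α + β + n + p.1 - 1) * Complex.exp (-t)) := by
  have hi := integrable_jkPolyIntegrand (κ := κ) (n := n) (x := x) (y := y) hα hβ hR hS t
  rw [Measure.volume_eq_prod] at hi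
  have hp := integral_prod _ hi
  simp only at hp
  rw [← hp, ← Measure.volume_eq_prod]
  simp only [jkPolyIntegrand_eq_sum]
  rw [integral_finsetSum _ fun p _ => (integrable_mul_hankelKernel hα hβ hR hS p).const_mul _]
  refine Finset.sum_congr rfl fun p _ => ?_
  rw [integral_const_mul, Measure.volume_eq_prod, integral_prod_mul,
    hankel_integral hR (re_one_add_add_natCast_pos hα _),
    hankel_integral hS (re_one_add_add_mul_natCast_pos hβ _ _), ← cpow_sub_one_mul_pow ht,
    show 1 + α + β + n - 1 = α + β + n by ring]
  simp only [div_eq_mul_inv]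
  linear_combination ((t : ℂ) ^ (α + β + n) * Complex.exp (-t) * (t : ℂ) ^ p.1 *
    polyCoeff κ n x y p * (Complex.Gamma (1 + α + p.1))⁻¹ *
    (Complex.Gamma (1 + β + κ * p.2))⁻¹ * 4 * (Real.pi : ℂ) ^ 2) * Complex.I_sq

lemma integrableOn_integral_jkPolyIntegrand (hα : -1 < α.re) (hβ : -1 < β.re)
    (hδ : 0 < (1 + α + β + n).re) {R S : ℝ → ℝ} (hRS : ∀ t, 0 < t → 0 < R t ∧ 0 < S t) :
    IntegrableOn (fun t : ℝ => ∫ σ, ∫ τ, jkPolyIntegrand κ n α β x y (R t) (S t) t σ τ)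
      (Ioi 0) := by
  refine IntegrableOn.congr_fun (integrable_finsetSum (triangle n) fun p _ =>
    (integrableOn_cpow_mul_exp_neg (re_add_natCast_pos hδ p.1)).const_mul
      (-(4 * (Real.pi : ℂ) ^ 2) * polyCoeff κ n x y p *
        ((Complex.Gamma (1 + α + p.1))⁻¹ * (Complex.Gamma (1 + β + κ * p.2))⁻¹)))
    (fun t ht => ?_) measurableSet_Ioi
  exact (integral_jkPolyIntegrand hα hβ (hRS t ht).1 (hRS t ht).2 ht).symm

theorem jkPoly_eq_integral (hα : -1 < α.re) (hβ : -1 < β.re)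
    (hδ : 0 < (1 + α + β + n).re) {R S : ℝ → ℝ} (hRS : ∀ t, 0 < t → 0 < R t ∧ 0 < S t) :
    jkPoly κ n α β x y = -Complex.Gamma (1 + α + n) /
        (4 * (Real.pi : ℂ) ^ 2 * Complex.Gamma (1 + α + β + n) * (n.factorial : ℂ)) *
      ∫ t in Ioi (0 : ℝ), ∫ σ : ℝ, ∫ τ : ℝ,
        jkPolyIntegrand κ n α β x y (R t) (S t) t σ τ := by
  have hI : ∫ t in Ioi (0 : ℝ), ∫ σ : ℝ, ∫ τ : ℝ,
      jkPolyIntegrand κ n α β x y (R t) (S t) t σ τ =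
      ∑ p ∈ triangle n, -(4 * (Real.pi : ℂ) ^ 2) * polyCoeff κ n x y p *
        ((Complex.Gamma (1 + α + p.1))⁻¹ * (Complex.Gamma (1 + β + κ * p.2))⁻¹) *
        ((ascPochhammer ℂ p.1).eval (1 + α + β + n) * Complex.Gamma (1 + α + β + n)) := by
    rw [setIntegral_congr_fun measurableSet_Ioi
      (fun t ht => integral_jkPolyIntegrand hα hβ (hRS t ht).1 (hRS t ht).2 ht),
      integral_finsetSum _ fun p _ =>
        (integrableOn_cpow_mul_exp_neg (re_add_natCast_pos hδ p.1)).const_mul _]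
    refine Finset.sum_congr rfl fun p _ => ?_
    rw [integral_const_mul, integral_cpow_mul_exp_neg (re_add_natCast_pos hδ _),
      Gamma_add_natCast hδ]
  have hG := Complex.Gamma_ne_zero_of_re_pos hδ
  have hpi : (Real.pi : ℂ) ≠ 0 := by exact_mod_cast Real.pi_ne_zero
  rw [hI, jkPoly, triangle, Finset.sum_sigma, Finset.mul_sum, Finset.mul_sum]
  refine Finset.sum_congr rfl fun s _ => ?_
  rw [Finset.mul_sum, Finset.mul_sum]
  refine Finset.sum_congr rfl fun r _ => ?_
  simp only [polyCoeff]
  rw [add_comm β 1]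
  have key : ∀ c G N G' Z W Q : ℂ, c ≠ 0 → G ≠ 0 →
      -G' / (c * G * N) * (-c * Z * W * (Q * G)) = G' / N * (Z * W * Q) := by
    intro c G N G' Z W Q hc hG
    rw [mul_right_comm c G N, mul_comm c N, div_mul_eq_mul_div, div_mul_eq_mul_div,
      show -G' * (-c * Z * W * (Q * G)) = G' * (Z * W * Q) * (c * G) by ring, mul_assoc N c G,
      mul_div_mul_right _ _ (mul_ne_zero hc hG)]
  rw [key _ _ _ _ _ _ _ (by simp [hpi]) hG]
  simp only [div_eq_mul_inv, mul_inv]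
  ring

end Poly

end JKML

end

theorem mainTheorem8 :
    (∀ α β κ γ₁ γ₂ x y : ℂ, 0 < α.re → 0 < β.re → 0 < κ.re → 0 < γ₂.re →
      ((‖x‖ < 1 ∨ ∃ n : ℕ, γ₁ = -(n : ℂ)) → JKML.SeriesConverges α β κ γ₁ γ₂ x y) ∧
      (∃ R S : ℝ → ℝ, JKML.AdmissibleRadii κ x y R S) ∧
      (JKML.SeriesConverges α β κ γ₁ γ₂ x y →
        ∀ R S : ℝ → ℝ, JKML.AdmissibleRadii κ x y R S →
          (∀ t : ℝ, 0 < t → MeasureTheory.Integrable (fun p : ℝ × ℝ =>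
            JKML.jkmlIntegrand α β κ γ₁ γ₂ x y (R t) (S t) t p.1 p.2)) ∧
          MeasureTheory.IntegrableOn (fun t : ℝ => ∫ σ : ℝ, ∫ τ : ℝ,
            JKML.jkmlIntegrand α β κ γ₁ γ₂ x y (R t) (S t) t σ τ) (Set.Ioi 0) ∧
          JKML.jkml α β κ γ₁ γ₂ x y =
            -1 / (4 * (Real.pi : ℂ) ^ 2 * Complex.Gamma γ₂) *
              ∫ t in Set.Ioi (0 : ℝ), ∫ σ : ℝ, ∫ τ : ℝ,
                JKML.jkmlIntegrand α β κ γ₁ γ₂ x y (R t) (S t) t σ τ)) ∧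
    (∀ (κ n : ℕ) (α β : ℝ) (x y : ℂ), 1 ≤ κ → -1 < α → -1 < β → 0 < 1 + α + β + n →
      ∀ R S : ℝ → ℝ, (∀ t : ℝ, 0 < t → 0 < R t ∧ 0 < S t) →
        (∀ t : ℝ, 0 < t → MeasureTheory.Integrable (fun p : ℝ × ℝ =>
          JKML.jkPolyIntegrand κ n α β x y (R t) (S t) t p.1 p.2)) ∧
        MeasureTheory.IntegrableOn (fun t : ℝ => ∫ σ : ℝ, ∫ τ : ℝ,
          JKML.jkPolyIntegrand κ n α β x y (R t) (S t) t σ τ) (Set.Ioi 0) ∧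
        JKML.jkPoly κ n α β x y =
          -Complex.Gamma (1 + α + n) /
              (4 * (Real.pi : ℂ) ^ 2 * Complex.Gamma (1 + α + β + n) * (n.factorial : ℂ)) *
            ∫ t in Set.Ioi (0 : ℝ), ∫ σ : ℝ, ∫ τ : ℝ,
              JKML.jkPolyIntegrand κ n α β x y (R t) (S t) t σ τ) := by
  refine ⟨fun α β κ γ₁ γ₂ x y hα hβ hκ hγ => ⟨?_, JKML.exists_admissibleRadii x y hκ,
    fun hs R S hRS => ⟨fun t ht => JKML.integrable_jkmlIntegrand hα hβ hκ hRS ht,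
      JKML.integrableOn_integral_jkmlIntegrand hα hβ hκ hγ hs hRS,
      JKML.jkml_eq_integral hα hβ hκ hγ hs hRS⟩⟩,
    fun κ n α β x y _ hα hβ hδ R S hRS => ?_⟩
  · rintro (hx | ⟨n, rfl⟩)
    · exact JKML.seriesConverges_of_norm_lt_one γ₁ γ₂ y hα hβ hκ hx
    · exact JKML.seriesConverges_of_neg_nat α β κ γ₂ x y n
  · have hα' : -1 < (α : ℂ).re := by simpa using hα
    have hβ' : -1 < (β : ℂ).re := by simpa using hβ
    have hδ' : 0 < (1 + (α : ℂ) + β + n).re := by simpa using hδ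
    exact ⟨fun t ht => JKML.integrable_jkPolyIntegrand hα' hβ' (hRS t ht).1 (hRS t ht).2 t,
      JKML.integrableOn_integral_jkPolyIntegrand hα' hβ' hδ' hRS,
      JKML.jkPoly_eq_integral hα' hβ' hδ' hRS⟩
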